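/- Let $1\le s\le d$ be integers and let $y\sim\mathcal N(\theta,I_d)$ with unknown $\theta\in\mathbb R^d$. For $F:\mathbb R\to\mathbb R$ put $\mathbf F(\theta)=\sum_{i=1}^d F(\theta_i)$; for $M>0$ let $\Theta_{s,M}$ be the set of $\theta\in\mathbb R^d$ with at most $s$ nonzero coordinates and $\max_i|\theta_i|\le M$; write $\|G\|_{\infty,[-M,M]}=\sup_{|x|\le M}|G(x)|$; and for real $K\ge 0$ let $$\delta_{K,M}=\inf\{\|F-P\|_{\infty,[-M,M]} : P \text{ a real polynomial of degree at most } K\}.$$ There exists an absolute constant $C\ge1$ such that for all $C_1'',C_2''>0$ there is a constant $C_3''>0$, depending only on $C_1''$ and $C_2''$, with the following property. Let $\epsilon_1,\epsilon_2\in\mathbb R$ satisfy $2\epsilon_1+2\epsilon_2<1$, let $1\le s\le d$ satisfy $s^2\ge Cd$, let $0<M\le\sqrt{\log(s^2/d)}$, let $F$ be continuous on $[-\sqrt{\log(s^2/d)},\sqrt{\log(s^2/d)}]$, put $$K=\frac{e^2\log(s^2/d)}{\log\big(e\log(s^2/d)/M^2\big)},$$ and suppose that $\delta_{K,M}>0$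 and $$\|F-F(0)\|_{\infty,[-M,M]}\le C_1''\Big(\frac{s^2}{d}\Big)^{\epsilon_1},\qquad \delta_{K,M}^{-1}\le C_2''\Big(\frac{s^2}{d}\Big)^{\epsilon_2}.$$ Then $$\inf_{\hat{\mathbf F}}\ \sup_{\theta\in\Theta_{s,M}}\mathbf E_\theta\big(\hat{\mathbf F}-\mathbf F(\theta)\big)^2\ \ge\ C_3''\,s^2\,\delta_{K,M}^2,$$ where the infimum is over all real-valued estimators $\hat{\mathbf F}$ based on $y$ (measurable functions of $y$, possibly also of independent randomization). -/

import Mathlib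

open MeasureTheory ProbabilityTheory

/-- The uniform norm `‖G‖_{∞,[a,b]} = sup_{x ∈ [a,b]} |G x|`. -/
noncomputable def supNormOn (G : ℝ → ℝ) (a b : ℝ) : ℝ :=
  ⨆ x : Set.Icc a b, |G x|

/-- The best polynomial approximation error `δ_{K,[a,b]}` of `F` on `[a,b]` in uniform norm
by real polynomials of degree at most `K`, where `K` is a real number. -/
noncomputable def polyApproxRate (F : ℝ → ℝ) (K a b : ℝ) : ℝ :=
  ⨅ P : {P : Polynomial ℝ // (P.natDegree : ℝ) ≤ K},
    supNormOn (fun x => F x - P.1.eval x) a b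

/-- The degree `K = e² log r / log (e log r / M²)`. -/
noncomputable def approxDegree (r M : ℝ) : ℝ :=
  Real.exp 2 * Real.log r / Real.log (Real.exp 1 * Real.log r / M ^ 2)

/-- The parameter set of vectors with at most `s` nonzero coordinates, all of them in `[-M, M]`.
(`hammingNorm` counts nonzero coordinates; the norm on `Fin d → ℝ` is the sup norm.) -/
def sparseSet (d s : ℕ) (M : ℝ) : Set (Fin d → ℝ) :=
  {θ | hammingNorm θ ≤ s ∧ ‖θ‖ ≤ M}

/-- The law `N(θ, I_d)` of the observation: independent coordinates `y i ∼ N(θ i, 1)`. -/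
noncomputable def gaussianMeanLaw {d : ℕ} (θ : Fin d → ℝ) : Measure (Fin d → ℝ) :=
  Measure.pi fun i => gaussianReal (θ i) 1

theorem gaussianMeanLaw_eq_map {d : ℕ} (θ : Fin d → ℝ) :
    gaussianMeanLaw θ =
      (Measure.pi fun _ : Fin d => gaussianReal 0 1).map (fun ξ => θ + ξ) := by
  have h := Measure.pi_map_pi (μ := fun _ : Fin d => gaussianReal 0 1)
    (f := fun i (x : ℝ) => θ i + x) (fun i => (measurable_const_add (θ i)).aemeasurable)
  simp only [gaussianReal_map_const_add, zero_add] at h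
  exact h.symm

theorem measurable_gaussianMeanLaw (d : ℕ) :
    Measurable (gaussianMeanLaw : (Fin d → ℝ) → Measure (Fin d → ℝ)) := by
  refine Measure.measurable_of_measurable_coe _ fun t ht => ?_
  have hm : MeasurableSet {p : (Fin d → ℝ) × (Fin d → ℝ) | p.1 + p.2 ∈ t} :=
    (measurable_fst.add measurable_snd) ht
  have h := measurable_measure_prodMk_left
    (ν := Measure.pi fun _ : Fin d => gaussianReal 0 1) hm
  convert h using 1
  funext θ
  rw [gaussianMeanLaw_eq_map, Measure.map_apply (measurable_const_add θ) ht]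
  rfl

/-- The Gaussian mean model with parameter set `Θ`: the family of laws `N(θ, I_d)`, `θ ∈ Θ`. -/
noncomputable def gaussianMeanModel {d : ℕ} (Θ : Set (Fin d → ℝ)) : Kernel Θ (Fin d → ℝ) where
  toFun θ := gaussianMeanLaw (θ : Fin d → ℝ)
  measurable' := (measurable_gaussianMeanLaw d).comp measurable_subtype_coe

/-- The additive functional with marginal `F`. -/
def additiveFunctional {d : ℕ} (F : ℝ → ℝ) (θ : Fin d → ℝ) : ℝ :=
  ∑ i, F (θ i)

/-- The minimax quadratic risk over `Θ` for estimating the additive functional with marginal `F`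
in the Gaussian mean model, with values in `[0, ∞]`: the infimum over all (possibly randomized)
estimators of the supremum over `θ ∈ Θ` of the mean squared error. -/
noncomputable def minimaxQuadraticRisk {d : ℕ} (F : ℝ → ℝ) (Θ : Set (Fin d → ℝ)) : ENNReal :=
  ProbabilityTheory.minimaxRisk
    (fun (θ : Θ) (t : ℝ) => ENNReal.ofReal ((t - additiveFunctional F (θ : Fin d → ℝ)) ^ 2))
    (gaussianMeanModel Θ)

/-! Write `r = s²/d`, `δ` for the approximation error and `B` for the sup norm of `F - F 0` on `[-M,
M]`. Polynomial approximation is dual to moment matching (`exists_moment_matching`): two probability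
measures on `[-M, M]` agree in all moments up to `K`, while their integrals of `F` differ by `2δ`.
Gaussian noise makes them nearly indistinguishable. The squared L² distance `Q` of the two mixture
densities relative to `N(0, 1)` is the series of squared moment differences over `n!`, and the
choice of `K` gives `Q ≤ 4 / r⁴` (`integral_mixtureRatio_sq_le_approxDegree`).

Spreading these measures over order `s` coordinates moves the functional by order `sδ`. Two fuzzy
hypotheses (`two_fuzzy_hypotheses`, `le_risk_of_contaminated`) then give risk of order `s²δ²`,
provided the functional concentrates at scale `sδ` under both priors. Its fluctuations may be of
order `B√s`, which leads to three regimes.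

If `B² ≤ sδ²/256`, i.i.d. sparse contamination works directly (`le_risk_of_small_oscillation`).
Otherwise the growth assumptions, which give `B² ≤ a² r δ²` with `a = C₁C₂`, force `s ≤ 256 a² r`.

For large `r`, `sQ` is then small, so `s` fixed coordinates can carry the priors with constant
proportion (`le_risk_of_close_mixtures`). Each term is recentred by its posterior mean under the
average of the two priors. Either the expected posterior variance is already of order `(sδ)²` and
bounds the risk by itself, or the recentred functional concentrates. In the latter case the gap
survives, because a bounded statistic has nearly equal means under two close mixtures.

For bounded `r`, `s` is bounded too, and one coordinate with two possible values suffices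
(`le_risk_of_two_points`). -/

/-! ### Uniform approximation and its dual, moment matching. -/

/-- In finite dimension the convex hull of a compact set is compact. -/
theorem IsCompact.convexHull_of_finiteDimensional {E : Type*} [NormedAddCommGroup E]
    [NormedSpace ℝ E] [FiniteDimensional ℝ E] {s : Set E} (hs : IsCompact s) :
    IsCompact (convexHull ℝ s) := by
  obtain rfl | ⟨x₀, hx₀⟩ := s.eq_empty_or_nonempty
  · simp
  -- Carathéodory: `finrank + 1` points always suffice. Shorter combinations are padded with weight
  -- `0` at `x₀`, so the hull is the image of one fixed compact set.
  set N := Module.finrank ℝ E + 1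
  let Φ : (Fin N → ℝ) × (Fin N → E) → E := fun p => ∑ i, p.1 i • p.2 i
  have hΦ : Continuous Φ := by fun_prop
  have himage : convexHull ℝ s = Φ '' (stdSimplex ℝ (Fin N) ×ˢ Set.univ.pi fun _ => s) := by
    apply Set.Subset.antisymm
    · intro x hx
      obtain ⟨ι, _, z, w, hz, hind, hw, hw1, hx⟩ := eq_pos_convex_span_of_mem_convexHull hx
      have hcard : Fintype.card ι ≤ Fintype.card (Fin N) := by
        have := hind.card_le_finrank_succ
        have h2 := Submodule.finrank_le (vectorSpan ℝ (Set.range z))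
        simp only [Fintype.card_fin]
        omega
      obtain ⟨e⟩ := Function.Embedding.nonempty_of_card_le hcard
      refine ⟨(Function.extend e w 0, Function.extend e z fun _ => x₀), ⟨⟨fun i => ?_, ?_⟩, ?_⟩, ?_⟩
      · by_cases h : ∃ a, e a = i
        · obtain ⟨a, rfl⟩ := h
          simpa [e.injective.extend_apply] using (hw a).le
        · simp [Function.extend_apply' _ _ _ h]
      · rw [← hw1]
        refine (Fintype.sum_of_injective e e.injective _ _ (fun i hi => ?_) fun a => ?_).symm
        · exact Function.extend_apply' _ _ _ (by simpa using hi)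
        · exact (e.injective.extend_apply _ _ _).symm
      · intro i _
        by_cases h : ∃ a, e a = i
        · obtain ⟨a, rfl⟩ := h
          simpa [e.injective.extend_apply] using hz ⟨a, rfl⟩
        · simpa [Function.extend_apply' _ _ _ h] using hx₀
      · rw [← hx]
        refine (Fintype.sum_of_injective e e.injective _ _ (fun i hi => ?_) fun a => ?_).symm
        · have : Function.extend e w 0 i = 0 :=
            Function.extend_apply' _ _ _ (by simpa using hi)
          simp [this]
        · simp [e.injective.extend_apply]
    · rintro _ ⟨⟨w, z⟩, ⟨hw, hz⟩, rfl⟩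
      exact mem_convexHull_of_exists_fintype w z hw.1 hw.2 (fun i => hz i trivial) rfl
  rw [himage]
  exact ((isCompact_stdSimplex ℝ (Fin N)).prod (isCompact_univ_pi fun _ => hs)).image hΦ

theorem bddAbove_range_abs_of_continuousOn {G : ℝ → ℝ} {a b : ℝ}
    (hG : ContinuousOn G (Set.Icc a b)) :
    BddAbove (Set.range fun x : Set.Icc a b => |G x|) := by
  have h := (isCompact_Icc (a := a) (b := b)).bddAbove_image hG.abs
  rwa [Set.image_eq_range] at h

theorem abs_le_supNormOn {G : ℝ → ℝ} {a b x : ℝ} (hG : ContinuousOn G (Set.Icc a b))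
    (hx : x ∈ Set.Icc a b) : |G x| ≤ supNormOn G a b :=
  le_ciSup (bddAbove_range_abs_of_continuousOn hG) ⟨x, hx⟩

theorem supNormOn_le {G : ℝ → ℝ} {a b c : ℝ} (hab : a ≤ b)
    (h : ∀ x ∈ Set.Icc a b, |G x| ≤ c) : supNormOn G a b ≤ c := by
  have : Nonempty (Set.Icc a b) := ⟨⟨a, le_rfl, hab⟩⟩
  exact ciSup_le fun x => h x x.2

theorem polyApproxRate_le (F : ℝ → ℝ) {K : ℝ} (a b : ℝ) (P : Polynomial ℝ)
    (hP : (P.natDegree : ℝ) ≤ K) :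
    polyApproxRate F K a b ≤ supNormOn (fun x => F x - P.eval x) a b := by
  refine ciInf_le (f := fun P : {P : Polynomial ℝ // (P.natDegree : ℝ) ≤ K} =>
    supNormOn (fun x => F x - P.1.eval x) a b) ⟨0, ?_⟩ ⟨P, hP⟩
  rintro _ ⟨Q, rfl⟩
  exact Real.iSup_nonneg fun x => abs_nonneg _

/-- Duality: the best approximation error is half the largest gap of integrals of `F` between
two probability measures with equal moments; finitely supported measures suffice. -/
theorem exists_moment_matching {F : ℝ → ℝ} {K M : ℝ} (hM : 0 < M) (hK : 0 ≤ K)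
    (hF : ContinuousOn F (Set.Icc (-M) M)) (hδ : 0 < polyApproxRate F K (-M) M) :
    ∃ (J : Type) (_ : Fintype J) (o : J) (t w₀ w₁ : J → ℝ), t o = 0 ∧ (∀ k, |t k| ≤ M) ∧
      (∀ k, 0 ≤ w₀ k) ∧ (∀ k, 0 ≤ w₁ k) ∧ ∑ k, w₀ k = 1 ∧ ∑ k, w₁ k = 1 ∧
      (∀ m : ℕ, (m : ℝ) ≤ K → ∑ k, (w₁ k - w₀ k) * t k ^ m = 0) ∧
      ∑ k, (w₁ k - w₀ k) * F (t k) = 2 * polyApproxRate F K (-M) M := by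
  set δ := polyApproxRate F K (-M) M with hδdef
  set n := ⌊K⌋₊
  let v : ℝ → (Fin (n + 1) → ℝ) × ℝ := fun x => (fun k => x ^ (k : ℕ), F x)
  have hv : ContinuousOn v (Set.Icc (-M) M) := by
    refine ContinuousOn.prodMk ?_ hF
    exact (continuous_pi fun k => continuous_pow _).continuousOn
  let A := convexHull ℝ (v '' Set.Icc (-M) M)
  have hAc : IsCompact A := (isCompact_Icc.image_of_continuousOn hv).convexHull_of_finiteDimensional
  have hAconv : Convex ℝ A := convex_convexHull ℝ _
  let c : (Fin (n + 1) → ℝ) × ℝ := (0, 2 * δ)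
  have hmem : ∀ x ∈ Set.Icc (-M) M, v x ∈ A := fun x hx =>
    subset_convexHull ℝ _ (Set.mem_image_of_mem v hx)
  -- A common point of `A` and `c + A` is a pair of measures with equal moments and gap `2δ`. A
  -- strictly separating functional would instead be a combination of monomials and `F` with
  -- oscillation below `2δ|β|`; dividing by `β` and centring at the midrange would approximate `F`
  -- better than `δ`.
  have hnd : ¬ Disjoint ((fun z => c + z) '' A) A := by
    intro hdis
    obtain ⟨f, a, b, hfa, hab, hfb⟩ := geometric_hahn_banach_compact_closed
      (hAconv.translate c) (hAc.image (by fun_prop)) hAconv hAc.isClosed hdis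
    have hfv : ∀ z : (Fin (n + 1) → ℝ) × ℝ,
        f z = ∑ k, z.1 k * f (Pi.single k 1, 0) + z.2 * f (0, 1) := by
      intro z
      have hz : z = ∑ k, z.1 k • ((Pi.single k 1, 0) : (Fin (n + 1) → ℝ) × ℝ)
          + z.2 • ((0, 1) : (Fin (n + 1) → ℝ) × ℝ) := by
        ext i
        · simp [Prod.fst_sum, Finset.sum_apply, Pi.single_apply]
        · simp [Prod.snd_sum]
      conv_lhs => rw [hz]
      simp only [map_add, map_sum, map_smul, smul_eq_mul]
    set β := f (0, 1)
    have hfc : f c = 2 * δ * β := by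
      have := hfv c
      simpa [c] using this
    have hkey : ∀ x ∈ Set.Icc (-M) M, ∀ y ∈ Set.Icc (-M) M, 2 * δ * β + f (v x) < f (v y) - (b - a) := by
      intro x hx y hy
      have h1 := hfa _ (Set.mem_image_of_mem (fun z => c + z) (hmem x hx))
      have h2 := hfb _ (hmem y hy)
      simp only [map_add, hfc] at h1
      linarith
    have h0 : (0 : ℝ) ∈ Set.Icc (-M) M := ⟨by linarith, hM.le⟩
    have hβ : β < 0 := by
      have := hkey 0 h0 0 h0
      by_contra hcon
      push Not at hcon
      have : 0 ≤ 2 * δ * β := by positivity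
      linarith
    -- the extremal values of `f ∘ v`
    have hfvc : ContinuousOn (fun x => f (v x)) (Set.Icc (-M) M) :=
      f.continuous.comp_continuousOn hv
    obtain ⟨x₁, hx₁, hmax⟩ := isCompact_Icc.exists_isMaxOn ⟨0, h0⟩ hfvc
    obtain ⟨x₂, hx₂, hmin⟩ := isCompact_Icc.exists_isMinOn ⟨0, h0⟩ hfvc
    have hosc := hkey x₁ hx₁ x₂ hx₂
    set mid := (f (v x₁) + f (v x₂)) / 2
    let P : Polynomial ℝ := Polynomial.C (mid / β) -
      ∑ k : Fin (n + 1), Polynomial.C (f (Pi.single k 1, 0) / β) * Polynomial.X ^ (k : ℕ)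
    have hdeg : (P.natDegree : ℝ) ≤ K := by
      have : P.natDegree ≤ n := by
        refine (Polynomial.natDegree_sub_le _ _).trans ?_
        refine max_le (by simp) ?_
        refine Polynomial.natDegree_sum_le_of_forall_le _ _ fun k _ => ?_
        exact (Polynomial.natDegree_C_mul_X_pow_le _ _).trans (by omega)
      exact (Nat.cast_le.mpr this).trans (Nat.floor_le hK)
    have hsup : supNormOn (fun x => F x - P.eval x) (-M) M ≤ δ + (b - a) / (2 * β) := by
      refine supNormOn_le (by linarith) fun x hx => ?_
      have hval : F x - P.eval x = (f (v x) - mid) / β := by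
        rw [hfv (v x)]
        simp only [P, Polynomial.eval_sub, Polynomial.eval_C, Polynomial.eval_finsetSum,
          Polynomial.eval_mul, Polynomial.eval_pow, Polynomial.eval_X, v]
        rw [sub_div, add_div, mul_div_cancel_right₀ _ hβ.ne, Finset.sum_div]
        have : ∑ k : Fin (n + 1), f (Pi.single k 1, 0) / β * x ^ (k : ℕ)
          = ∑ k : Fin (n + 1), x ^ (k : ℕ) * f (Pi.single k 1, 0) / β :=
          Finset.sum_congr rfl fun k _ => by ring
        rw [this]
        ring
      rw [hval, abs_div, abs_of_neg hβ, div_le_iff₀ (by linarith)]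
      have e1 : (δ + (b - a) / (2 * β)) * -β = - (δ * β) - (b - a) / 2 := by
        have := hβ.ne
        field_simp
        ring
      rw [e1, abs_le]
      have h1 : f (v x) ≤ f (v x₁) := hmax hx
      have h2 : f (v x₂) ≤ f (v x) := hmin hx
      constructor <;> simp only [mid] <;> linarith
    have := polyApproxRate_le F (-M) M P hdeg
    have hneg : (b - a) / (2 * β) < 0 := div_neg_of_pos_of_neg (by linarith) (by linarith)
    linarith
  rw [Set.not_disjoint_iff] at hnd
  obtain ⟨_, ⟨z, hz, rfl⟩, hz'⟩ := hnd
  obtain ⟨ι₀, _, a₀, p₀, ha₀, ha₀1, hp₀, hs₀⟩ := mem_convexHull_iff_exists_fintype.mp hz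
  obtain ⟨ι₁, _, a₁, p₁, ha₁, ha₁1, hp₁, hs₁⟩ := mem_convexHull_iff_exists_fintype.mp hz'
  choose x₀ hx₀ hxp₀ using hp₀
  choose x₁ hx₁ hxp₁ using hp₁
  have hmom : ∀ m : ℕ, (m : ℝ) ≤ K → ∑ i, a₁ i * x₁ i ^ m = ∑ i, a₀ i * x₀ i ^ m := by
    intro m hm
    have hmn : m < n + 1 := Nat.lt_succ_of_le (Nat.le_floor hm)
    have e₀ := congrArg (fun q => q.1 ⟨m, hmn⟩) hs₀
    have e₁ := congrArg (fun q => q.1 ⟨m, hmn⟩) hs₁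
    simp only [Prod.fst_sum, Finset.sum_apply, Prod.smul_fst, Pi.smul_apply, ← hxp₀, ← hxp₁, v,
      smul_eq_mul, Prod.fst_add, c, Pi.add_apply, Pi.zero_apply, zero_add] at e₀ e₁
    rw [e₀, e₁]
  have hval : ∑ i, a₁ i * F (x₁ i) = 2 * δ + ∑ i, a₀ i * F (x₀ i) := by
    have e₀ := congrArg Prod.snd hs₀
    have e₁ := congrArg Prod.snd hs₁
    simp only [Prod.snd_sum, Prod.smul_snd, ← hxp₀, ← hxp₁, v, smul_eq_mul, Prod.snd_add, c]
      at e₀ e₁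
    rw [e₀, e₁]
  -- Both measures are put on one index set. The extra label `none` at position `0` has weight zero
  -- under both and later carries the null component of the priors.
  refine ⟨Option (ι₀ ⊕ ι₁), inferInstance, none, fun k => k.elim 0 (Sum.elim x₀ x₁),
    fun k => k.elim 0 (Sum.elim a₀ 0), fun k => k.elim 0 (Sum.elim 0 a₁), rfl, ?_, ?_, ?_, ?_, ?_,
    ?_, ?_⟩
  · rintro (_ | i | i)
    · simpa using hM.le
    · exact abs_le.mpr (hx₀ i)
    · exact abs_le.mpr (hx₁ i)
  · rintro (_ | i | i) <;> simp [ha₀]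
  · rintro (_ | i | i) <;> simp [ha₁]
  · simp [Fintype.sum_option, Fintype.sum_sum_type, ha₀1]
  · simp [Fintype.sum_option, Fintype.sum_sum_type, ha₁1]
  · intro m hm
    simp [Fintype.sum_option, Fintype.sum_sum_type, hmom m hm]
  · simp [Fintype.sum_option, Fintype.sum_sum_type, hval]

/-! ### Gaussian likelihood ratios. -/

/-- The likelihood ratio of `N(t, 1)` with respect to `N(0, 1)`. -/
noncomputable def gaussianRatio (t y : ℝ) : ℝ := Real.exp (t * y - t ^ 2 / 2)

theorem gaussianRatio_pos (t y : ℝ) : 0 < gaussianRatio t y := Real.exp_pos _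

@[simp] theorem gaussianRatio_zero (y : ℝ) : gaussianRatio 0 y = 1 := by simp [gaussianRatio]

@[fun_prop] theorem continuous_gaussianRatio (t : ℝ) : Continuous (gaussianRatio t) := by
  unfold gaussianRatio; fun_prop

@[fun_prop] theorem measurable_gaussianRatio (t : ℝ) : Measurable (gaussianRatio t) :=
  (continuous_gaussianRatio t).measurable

theorem gaussianReal_eq_withDensity_ratio (t : ℝ) :
    gaussianReal t 1 =
      (gaussianReal 0 1).withDensity fun y => ENNReal.ofReal (gaussianRatio t y) := by
  rw [gaussianReal_of_var_ne_zero _ one_ne_zero, gaussianReal_of_var_ne_zero _ one_ne_zero,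
    ← withDensity_mul _ (measurable_gaussianPDF 0 1) (by fun_prop)]
  congr 1
  funext y
  simp only [Pi.mul_apply, gaussianPDF, gaussianRatio]
  rw [← ENNReal.ofReal_mul (gaussianPDFReal_nonneg _ _ _), gaussianPDFReal, gaussianPDFReal,
    mul_assoc _ (Real.exp _) (Real.exp _), ← Real.exp_add]
  congr 3
  simp
  ring

theorem gaussianRatio_mul (s t y : ℝ) :
    gaussianRatio s y * gaussianRatio t y = Real.exp (s * t) * gaussianRatio (s + t) y := by
  simp only [gaussianRatio, ← Real.exp_add]
  congr 1
  ring

theorem integrable_gaussianRatio (t : ℝ) : Integrable (gaussianRatio t) (gaussianReal 0 1) := by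
  have h := (integrable_exp_mul_gaussianReal (μ := 0) (v := 1) t).mul_const
    (Real.exp (-(t ^ 2 / 2)))
  refine h.congr (ae_of_all _ fun y => ?_)
  simp [gaussianRatio, ← Real.exp_add, sub_eq_add_neg]

theorem integral_gaussianRatio (t : ℝ) : ∫ y, gaussianRatio t y ∂gaussianReal 0 1 = 1 := by
  have h := congrFun (mgf_id_gaussianReal (μ := 0) (v := 1)) t
  simp only [mgf, id] at h
  have h2 : gaussianRatio t = fun y => Real.exp (t * y) * Real.exp (-(t ^ 2 / 2)) := by
    funext y
    simp [gaussianRatio, ← Real.exp_add, sub_eq_add_neg]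
  rw [h2, integral_mul_const, h, ← Real.exp_add]
  simp

theorem integrable_gaussianRatio_mul (s t : ℝ) :
    Integrable (fun y => gaussianRatio s y * gaussianRatio t y) (gaussianReal 0 1) := by
  simp only [gaussianRatio_mul]
  exact (integrable_gaussianRatio _).const_mul _

theorem integral_gaussianRatio_mul (s t : ℝ) :
    ∫ y, gaussianRatio s y * gaussianRatio t y ∂gaussianReal 0 1 = Real.exp (s * t) := by
  simp only [gaussianRatio_mul, integral_const_mul, integral_gaussianRatio, mul_one]

/-! ### Densities and mixtures of product measures. -/

theorem lintegral_pi_prod {ι : Type*} [Fintype ι] {X : ι → Type*} [∀ i, MeasurableSpace (X i)]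
    (μ : ∀ i, Measure (X i)) [∀ i, IsProbabilityMeasure (μ i)] {f : ∀ i, X i → ENNReal}
    (hf : ∀ i, Measurable (f i)) :
    ∫⁻ x, ∏ i, f i (x i) ∂Measure.pi μ = ∏ i, ∫⁻ x, f i x ∂μ i := by
  refine (lintegral_prod_eq_prod_lintegral_of_indepFun Finset.univ (fun i (x : ∀ i, X i) => f i (x i))
    (iIndepFun_pi fun i => (hf i).aemeasurable) fun i =>
      (hf i).comp (measurable_pi_apply i)).trans ?_
  exact Finset.prod_congr rfl fun i _ => (measurePreserving_eval μ i).lintegral_comp (hf i)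

theorem pi_withDensity {ι : Type*} [Fintype ι] {X : ι → Type*} [∀ i, MeasurableSpace (X i)]
    (μ : ∀ i, Measure (X i)) [∀ i, IsProbabilityMeasure (μ i)] {f : ∀ i, X i → ENNReal}
    (hf : ∀ i, Measurable (f i)) [∀ i, SigmaFinite ((μ i).withDensity (f i))] :
    Measure.pi (fun i => (μ i).withDensity (f i)) =
      (Measure.pi μ).withDensity fun x => ∏ i, f i (x i) := by
  refine Measure.pi_eq fun s hs => ?_
  rw [withDensity_apply _ (.univ_pi hs), ← lintegral_indicator (.univ_pi hs)]
  have : (Set.univ.pi s).indicator (fun x : ∀ i, X i => ∏ i, f i (x i)) =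
      fun x => ∏ i, (s i).indicator (f i) (x i) := by
    funext x
    by_cases hx : x ∈ Set.univ.pi s
    · rw [Set.indicator_of_mem hx]
      exact Finset.prod_congr rfl fun i _ => (Set.indicator_of_mem (hx i trivial) _).symm
    · rw [Set.indicator_of_notMem hx]
      simp only [Set.mem_pi, Set.mem_univ, true_implies, not_forall] at hx
      obtain ⟨i, hi⟩ := hx
      exact (Finset.prod_eq_zero (Finset.mem_univ i) (Set.indicator_of_notMem hi _)).symm
  rw [this, lintegral_pi_prod μ fun i => (hf i).indicator (hs i)]
  exact Finset.prod_congr rfl fun i _ => by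
    rw [lintegral_indicator (hs i), withDensity_apply _ (hs i)]

theorem pi_finset_sum_smul {ι J : Type*} [Fintype ι] [Fintype J] {X : Type*} [MeasurableSpace X]
    (c : ι → J → ENNReal) (μ : ι → J → Measure X) [∀ i j, SigmaFinite (μ i j)]
    [∀ i, SigmaFinite (∑ j, c i j • μ i j)] [DecidableEq ι] :
    Measure.pi (fun i => ∑ j, c i j • μ i j) =
      ∑ α : ι → J, (∏ i, c i (α i)) • Measure.pi fun i => μ i (α i) := by
  refine Measure.pi_eq fun s hs => ?_
  simp only [Measure.coe_finsetSum, Finset.sum_apply, Measure.smul_apply, smul_eq_mul,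
    Measure.pi_pi, ← Finset.prod_mul_distrib]
  rw [Finset.prod_univ_sum, Fintype.piFinset_univ]

/-! ### Gaussian mixtures and the joint law of label and observation. -/

/-- The density, with respect to `N(0, 1)`, of the mixture of the laws `N(t k, 1)` with
weights `u k`. -/
noncomputable def mixtureRatio {J : Type} [Fintype J] (t u : J → ℝ) (y : ℝ) : ℝ :=
  ∑ k, u k * gaussianRatio (t k) y

@[fun_prop] theorem continuous_mixtureRatio {J : Type} [Fintype J] (t u : J → ℝ) :
    Continuous (mixtureRatio t u) := by
  unfold mixtureRatio; fun_prop

@[fun_prop] theorem measurable_mixtureRatio {J : Type} [Fintype J] (t u : J → ℝ) :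
    Measurable (mixtureRatio t u) := (continuous_mixtureRatio t u).measurable

theorem integrable_mixtureRatio {J : Type} [Fintype J] (t u : J → ℝ) :
    Integrable (mixtureRatio t u) (gaussianReal 0 1) :=
  integrable_finsetSum _ fun k _ => (integrable_gaussianRatio (t k)).const_mul (u k)

theorem integral_mixtureRatio {J : Type} [Fintype J] (t u : J → ℝ) :
    ∫ y, mixtureRatio t u y ∂gaussianReal 0 1 = ∑ k, u k := by
  simp only [mixtureRatio]
  rw [integral_finsetSum _ fun k _ => (integrable_gaussianRatio (t k)).const_mul (u k)]
  simp [integral_const_mul, integral_gaussianRatio]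

theorem mixtureRatio_nonneg {J : Type} [Fintype J] (t : J → ℝ) {u : J → ℝ} (hu : ∀ k, 0 ≤ u k)
    (y : ℝ) : 0 ≤ mixtureRatio t u y :=
  Finset.sum_nonneg fun k _ => mul_nonneg (hu k) (gaussianRatio_pos _ _).le

/-- The component at `0` has likelihood ratio identically `1`. A positive weight there therefore
keeps the mixture density away from zero, which makes the later divisions and chi-square bounds
possible. -/
theorem le_mixtureRatio {J : Type} [Fintype J] {t u : J → ℝ} (hu : ∀ k, 0 ≤ u k) {o : J}
    (ho : t o = 0) (y : ℝ) : u o ≤ mixtureRatio t u y := by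
  have h := Finset.single_le_sum (f := fun k => u k * gaussianRatio (t k) y)
    (fun k _ => mul_nonneg (hu k) (gaussianRatio_pos _ _).le) (Finset.mem_univ o)
  simp only [ho, gaussianRatio_zero, mul_one] at h
  exact h

theorem isProbabilityMeasure_map_prodMk {J : Type} [MeasurableSpace J] (k : J) (s : ℝ) :
    IsProbabilityMeasure ((gaussianReal s 1).map fun y => (k, y)) :=
  Measure.isProbabilityMeasure_map measurable_prodMk_left.aemeasurable

section JointLaw

variable {J : Type} [Fintype J] [MeasurableSpace J]

/-- The joint law of `(k, y)` where `k` has weights `u` and `y ∼ N(t k, 1)` given `k`. -/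
noncomputable def jointLaw (t u : J → ℝ) : Measure (J × ℝ) :=
  ∑ k, ENNReal.ofReal (u k) • (gaussianReal (t k) 1).map fun y => (k, y)

theorem isProbabilityMeasure_jointLaw (t : J → ℝ) {u : J → ℝ} (hu : ∀ k, 0 ≤ u k)
    (hu1 : ∑ k, u k = 1) : IsProbabilityMeasure (jointLaw t u) := by
  refine ⟨?_⟩
  have h := fun k => (isProbabilityMeasure_map_prodMk k (t k)).measure_univ
  simp only [jointLaw, Measure.coe_finsetSum, Finset.sum_apply, Measure.smul_apply, smul_eq_mul,
    h, mul_one]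
  rw [← ENNReal.ofReal_sum_of_nonneg fun k _ => hu k, hu1, ENNReal.ofReal_one]

theorem lintegral_jointLaw (t u : J → ℝ) {g : J × ℝ → ENNReal} (hg : Measurable g) :
    ∫⁻ z, g z ∂jointLaw t u =
      ∑ k, ENNReal.ofReal (u k) * ∫⁻ y, g (k, y) ∂gaussianReal (t k) 1 := by
  simp only [jointLaw, lintegral_finsetSum_measure, lintegral_smul_measure, smul_eq_mul,
    lintegral_map hg measurable_prodMk_left]

theorem jointLaw_map_snd (t : J → ℝ) {u : J → ℝ} (hu : ∀ k, 0 ≤ u k) :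
    (jointLaw t u).map Prod.snd =
      (gaussianReal 0 1).withDensity fun y => ENNReal.ofReal (mixtureRatio t u y) := by
  refine Measure.ext_of_lintegral _ fun g hg => ?_
  have hj := lintegral_jointLaw t u (hg.comp measurable_snd)
  simp only [Function.comp_apply] at hj
  rw [lintegral_map hg measurable_snd, hj,
    lintegral_withDensity_eq_lintegral_mul _ (by fun_prop) hg]
  simp only [gaussianReal_eq_withDensity_ratio (t _)]
  have : ∀ y, ENNReal.ofReal (mixtureRatio t u y) * g y =
      ∑ k, ENNReal.ofReal (u k) * (ENNReal.ofReal (gaussianRatio (t k) y) * g y) := by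
    intro y
    rw [mixtureRatio, ENNReal.ofReal_sum_of_nonneg fun k _ =>
      mul_nonneg (hu k) (gaussianRatio_pos _ _).le, Finset.sum_mul]
    exact Finset.sum_congr rfl fun k _ => by rw [ENNReal.ofReal_mul (hu k), mul_assoc]
  simp only [Pi.mul_apply, this]
  rw [lintegral_finsetSum _ fun k _ => by fun_prop]
  refine Finset.sum_congr rfl fun k _ => ?_
  rw [lintegral_withDensity_eq_lintegral_mul _ (by fun_prop) (by fun_prop),
    lintegral_const_mul _ (by fun_prop)]
  rfl

theorem integrable_of_measurable_of_bounded {X : Type*} [MeasurableSpace X] {μ : Measure X}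
    [IsFiniteMeasure μ] {g : X → ℝ} (hg : Measurable g) {c : ℝ} (hc : ∀ x, |g x| ≤ c) :
    Integrable g μ :=
  Integrable.of_bound hg.aestronglyMeasurable c (ae_of_all _ hc)

theorem integral_jointLaw (t : J → ℝ) {u : J → ℝ} (hu : ∀ k, 0 ≤ u k) {g : J × ℝ → ℝ}
    (hg : Measurable g) {c : ℝ} (hc : ∀ z, |g z| ≤ c) :
    ∫ z, g z ∂jointLaw t u =
      ∫ y, ∑ k, u k * gaussianRatio (t k) y * g (k, y) ∂gaussianReal 0 1 := by
  have hk : ∀ k, Measurable fun y => g (k, y) := fun k => hg.comp measurable_prodMk_left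
  have hint : ∀ k, Integrable (fun y => u k * gaussianRatio (t k) y * g (k, y))
      (gaussianReal 0 1) := fun k =>
    ((integrable_gaussianRatio (t k)).const_mul (u k)).mul_bdd (c := c) (hk k).aestronglyMeasurable
      (ae_of_all _ fun y => hc _)
  rw [jointLaw, integral_finsetSum_measure, integral_finsetSum _ fun k _ => hint k]
  · refine Finset.sum_congr rfl fun k _ => ?_
    rw [integral_smul_measure, integral_map measurable_prodMk_left.aemeasurable
      hg.aestronglyMeasurable, gaussianReal_eq_withDensity_ratio,
      integral_withDensity_eq_integral_toReal_smul (by fun_prop) (by simp),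
      ENNReal.toReal_ofReal (hu k), smul_eq_mul, ← integral_const_mul]
    refine integral_congr_ae (ae_of_all _ fun y => ?_)
    simp only [ENNReal.toReal_ofReal (gaussianRatio_pos _ _).le, smul_eq_mul]
    ring
  · intro k _
    have := isProbabilityMeasure_map_prodMk k (t k)
    exact (integrable_of_measurable_of_bounded hg hc).smul_measure ENNReal.ofReal_ne_top

theorem pi_jointLaw_map_snd {d : ℕ} (t : J → ℝ) {u : Fin d → J → ℝ} (hu : ∀ i k, 0 ≤ u i k)
    (hu1 : ∀ i, ∑ k, u i k = 1) :
    (Measure.pi fun i => jointLaw t (u i)).map (fun ω i => (ω i).2) =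
      (Measure.pi fun _ => gaussianReal 0 1).withDensity
        fun y => ∏ i, ENNReal.ofReal (mixtureRatio t (u i) (y i)) := by
  have hp := fun i => isProbabilityMeasure_jointLaw t (hu i) (hu1 i)
  have h : ∀ i : Fin d, (jointLaw t (u i)).map Prod.snd = (gaussianReal 0 1).withDensity
      fun y => ENNReal.ofReal (mixtureRatio t (u i) y) := fun i => jointLaw_map_snd t (hu i)
  have hp' : ∀ i : Fin d, IsProbabilityMeasure ((gaussianReal 0 1).withDensity
      fun y => ENNReal.ofReal (mixtureRatio t (u i) y)) := fun i => by
    rw [← h i]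
    exact Measure.isProbabilityMeasure_map measurable_snd.aemeasurable
  have hp'' : ∀ i : Fin d, IsProbabilityMeasure ((jointLaw t (u i)).map Prod.snd) := fun i => by
    rw [h i]; infer_instance
  rw [← pi_withDensity (fun _ => gaussianReal 0 1)
    (f := fun i y => ENNReal.ofReal (mixtureRatio t (u i) y)) fun i => by fun_prop,
    Measure.pi_map_pi (f := fun (_ : Fin d) (z : J × ℝ) => z.2)
      fun i => measurable_snd.aemeasurable]
  exact congrArg Measure.pi (funext h)

variable [DiscreteMeasurableSpace J]

/-- A product of mixtures is a mixture of products over label configurations `α`. This is how the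
average risk under a product prior becomes a weighted sum of risks at fixed parameters. -/
theorem lintegral_pi_jointLaw {d : ℕ} (t : J → ℝ) {u : Fin d → J → ℝ} (hu : ∀ i k, 0 ≤ u i k)
    (hu1 : ∀ i, ∑ k, u i k = 1) {Φ : (Fin d → J) → (Fin d → ℝ) → ENNReal}
    (hΦ : ∀ α, Measurable (Φ α)) :
    ∫⁻ ω, Φ (fun i => (ω i).1) (fun i => (ω i).2) ∂Measure.pi (fun i => jointLaw t (u i)) =
      ∑ α : Fin d → J, ENNReal.ofReal (∏ i, u i (α i)) *
        ∫⁻ y, Φ α y ∂gaussianMeanLaw (fun i => t (α i)) := by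
  have hΦ' : Measurable fun ω : Fin d → J × ℝ => Φ (fun i => (ω i).1) (fun i => (ω i).2) := by
    have h : Measurable (Function.uncurry Φ) := measurable_from_prod_countable_right hΦ
    exact h.comp (by fun_prop : Measurable fun ω : Fin d → J × ℝ =>
      ((fun i => (ω i).1 : Fin d → J), (fun i => (ω i).2 : Fin d → ℝ)))
  have hp : ∀ (i : Fin d) (k : J), IsProbabilityMeasure
      ((gaussianReal (t k) 1).map fun y => (k, y)) :=
    fun _ k => isProbabilityMeasure_map_prodMk k (t k)
  have hp' : ∀ i : Fin d, IsProbabilityMeasure (∑ k, ENNReal.ofReal (u i k) •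
      (gaussianReal (t k) 1).map fun y => (k, y)) :=
    fun i => isProbabilityMeasure_jointLaw t (hu i) (hu1 i)
  simp only [jointLaw]
  rw [pi_finset_sum_smul (fun i k => ENNReal.ofReal (u i k))
    (fun (_ : Fin d) k => (gaussianReal (t k) 1).map fun y => (k, y)),
    lintegral_finsetSum_measure]
  refine Finset.sum_congr rfl fun α _ => ?_
  rw [lintegral_smul_measure, smul_eq_mul, ENNReal.ofReal_prod_of_nonneg fun i _ => hu i _,
    ← Measure.pi_map_pi fun i => measurable_prodMk_left.aemeasurable,
    lintegral_map hΦ' (by fun_prop)]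
  rfl

/-- Chebyshev's inequality for sums of bounded independent variables. -/
theorem pi_deviation_le {ι : Type*} [Fintype ι] {X : ι → Type*} [∀ i, MeasurableSpace (X i)]
    (μ : ∀ i, Measure (X i)) [∀ i, IsProbabilityMeasure (μ i)] {g : ∀ i, X i → ℝ}
    (hg : ∀ i, Measurable (g i)) {c : ℝ} (hc : ∀ i x, |g i x| ≤ c) {v : ℝ}
    (hv : ∑ i, ∫ x, g i x ^ 2 ∂μ i ≤ v) {a : ℝ} (ha : 0 < a) :
    Measure.pi μ {ω | a ≤ |∑ i, g i (ω i) - ∑ i, ∫ x, g i x ∂μ i|} ≤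
      ENNReal.ofReal (v / a ^ 2) := by
  have hL : ∀ i, MemLp (g i) 2 (μ i) := fun i =>
    MemLp.of_bound (hg i).aestronglyMeasurable c (ae_of_all _ (hc i))
  have hL' : MemLp (∑ i, fun ω : ∀ i, X i => g i (ω i)) 2 (Measure.pi μ) :=
    memLp_finsetSum' _ fun i _ => (hL i).comp_measurePreserving (measurePreserving_eval μ i)
  have hmean : ∫ ω, (∑ i, fun ω : ∀ i, X i => g i (ω i)) ω ∂Measure.pi μ =
      ∑ i, ∫ x, g i x ∂μ i := by
    simp only [Finset.sum_apply]
    rw [integral_finsetSum]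
    · exact Finset.sum_congr rfl fun i _ => integral_comp_eval (hg i).aestronglyMeasurable
    · exact fun i _ => integrable_comp_eval
        (integrable_of_measurable_of_bounded (hg i) (hc i))
  have h := meas_ge_le_variance_div_sq hL' ha
  rw [hmean, variance_sum_pi hL] at h
  simp only [Finset.sum_apply] at h
  refine h.trans (ENNReal.ofReal_le_ofReal ?_)
  gcongr
  refine le_trans (Finset.sum_le_sum fun i _ => ?_) hv
  exact variance_le_expectation_sq (hg i).aestronglyMeasurable

end JointLaw

theorem sum_prod_eq_one {d : ℕ} {J : Type} [Fintype J] {u : Fin d → J → ℝ}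
    (hu1 : ∀ i, ∑ k, u i k = 1) : ∑ α : Fin d → J, ∏ i, u i (α i) = 1 := by
  rw [← Fintype.piFinset_univ, ← Finset.prod_univ_sum]
  simp [hu1]

/-! ### Two fuzzy hypotheses with randomized tests. -/

section FuzzyHypotheses

variable {J : Type} [Fintype J] [MeasurableSpace J] [DiscreteMeasurableSpace J]

/-- A mixture of sampling laws puts little mass on a randomized test `ψ` which forces
a squared error of at least `c ^ 2`. -/
theorem mul_lintegral_test_le {d : ℕ} {κ : Kernel (Fin d → ℝ) ℝ} {t φ : J → ℝ}
    {u : Fin d → J → ℝ} (hu : ∀ i k, 0 ≤ u i k) (hu1 : ∀ i, ∑ k, u i k = 1)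
    {f : Fin d → ℝ → ℝ} (hf : ∀ i, Measurable (f i)) {good : Set (Fin d → J)} {R : ENNReal}
    (hR : ∀ α ∈ good, ∫⁻ y, ∫⁻ x, ENNReal.ofReal ((x - ∑ i, φ (α i)) ^ 2) ∂κ y
      ∂gaussianMeanLaw (fun i => t (α i)) ≤ R)
    {m c b : ℝ} {ψ : (Fin d → ℝ) → ENNReal} (hψ : Measurable ψ) (hψ1 : ∀ y, ψ y ≤ 1)
    (htest : ∀ α ∈ good, ∀ y : Fin d → ℝ, |∑ i, (φ (α i) - f i (y i)) - m| < c →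
      ENNReal.ofReal (c ^ 2) * ψ y ≤ ∫⁻ x, ENNReal.ofReal ((x - ∑ i, φ (α i)) ^ 2) ∂κ y)
    (hb : Measure.pi (fun i => jointLaw t (u i)) {ω | (fun i => (ω i).1) ∉ good ∨
      c ≤ |∑ i, (φ (ω i).1 - f i (ω i).2) - m|} ≤ ENNReal.ofReal b) :
    ENNReal.ofReal (c ^ 2) * ∫⁻ y, (∏ i, ENNReal.ofReal (mixtureRatio t (u i) (y i))) * ψ y
      ∂Measure.pi (fun _ => gaussianReal 0 1) ≤
        R + ENNReal.ofReal (c ^ 2) * ENNReal.ofReal b := by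
  classical
  set P := Measure.pi fun i => jointLaw t (u i)
  set bad := {ω : Fin d → J × ℝ | (fun i => (ω i).1) ∉ good ∨
      c ≤ |∑ i, (φ (ω i).1 - f i (ω i).2) - m|}
  have hφ : Measurable φ := measurable_of_countable φ
  have hbad : MeasurableSet bad := by
    refine MeasurableSet.union ?_ ?_
    · have hg : MeasurableSet goodᶜ := MeasurableSet.of_discrete
      have hfst : Measurable fun ω : Fin d → J × ℝ => (fun i => (ω i).1 : Fin d → J) := by
        fun_prop
      exact hfst hg
    · have hdev : Measurable fun ω : Fin d → J × ℝ => |∑ i, (φ (ω i).1 - f i (ω i).2) - m| :=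
        ((Finset.measurable_sum _ fun i _ =>
          ((hφ.comp (measurable_fst.comp (measurable_pi_apply i))).sub
            ((hf i).comp (measurable_snd.comp (measurable_pi_apply i))))).sub_const m).abs
      exact measurableSet_le measurable_const hdev
  -- The risk is controlled only on `good`, so the loss is set to `0` elsewhere; the other labels
  -- are absorbed in `bad`.
  let Φ : (Fin d → J) → (Fin d → ℝ) → ENNReal := fun α y =>
    if α ∈ good then ∫⁻ x, ENNReal.ofReal ((x - ∑ i, φ (α i)) ^ 2) ∂κ y else 0
  have hΦ : ∀ α, Measurable (Φ α) := by
    intro α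
    by_cases hα : α ∈ good
    · simp only [Φ, hα, if_true]
      exact Measurable.lintegral_kernel (by fun_prop)
    · simp only [Φ, hα, if_false]
      exact measurable_const
  have hrisk : ∫⁻ ω, Φ (fun i => (ω i).1) (fun i => (ω i).2) ∂P ≤ R := by
    rw [lintegral_pi_jointLaw t hu hu1 hΦ]
    have h1 : ∀ α : Fin d → J, ENNReal.ofReal (∏ i, u i (α i)) *
        ∫⁻ y, Φ α y ∂gaussianMeanLaw (fun i => t (α i)) ≤ ENNReal.ofReal (∏ i, u i (α i)) * R := by
      intro α
      gcongr
      by_cases hα : α ∈ good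
      · simp only [Φ, hα, if_true]
        exact hR α hα
      · simp [Φ, hα]
    refine (Finset.sum_le_sum fun α _ => h1 α).trans ?_
    rw [← Finset.sum_mul, ← ENNReal.ofReal_sum_of_nonneg
      fun α _ => Finset.prod_nonneg fun i _ => hu i _, sum_prod_eq_one hu1]
    simp
  have hsnd : Measurable fun ω : Fin d → J × ℝ => (fun i => (ω i).2 : Fin d → ℝ) := by fun_prop
  have hlaw : ∫⁻ y, (∏ i, ENNReal.ofReal (mixtureRatio t (u i) (y i))) * ψ y
      ∂Measure.pi (fun _ => gaussianReal 0 1) = ∫⁻ ω, ψ (fun i => (ω i).2) ∂P := by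
    have h := lintegral_map (μ := P) hψ hsnd
    rw [← h, pi_jointLaw_map_snd t hu hu1,
      lintegral_withDensity_eq_lintegral_mul _ (by fun_prop) hψ]
    rfl
  have hψsnd : Measurable fun ω : Fin d → J × ℝ => ψ fun i => (ω i).2 := hψ.comp hsnd
  rw [hlaw, ← lintegral_const_mul _ hψsnd]
  calc ∫⁻ ω, ENNReal.ofReal (c ^ 2) * ψ (fun i => (ω i).2) ∂P
      ≤ ∫⁻ ω, (Φ (fun i => (ω i).1) (fun i => (ω i).2) +
          bad.indicator (fun _ => ENNReal.ofReal (c ^ 2)) ω) ∂P := by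
        refine lintegral_mono fun ω => ?_
        by_cases hω : ω ∈ bad
        · rw [Set.indicator_of_mem hω]
          refine le_trans ?_ le_add_self
          exact mul_le_of_le_one_right' (hψ1 _)
        · simp only [bad, Set.mem_ofPred_eq, not_or, not_not, not_le] at hω
          refine le_trans ?_ le_self_add
          simp only [Φ, hω.1, if_true]
          exact htest _ hω.1 _ hω.2
    _ = (∫⁻ ω, Φ (fun i => (ω i).1) (fun i => (ω i).2) ∂P) + ENNReal.ofReal (c ^ 2) * P bad := by
        rw [lintegral_add_right _ (measurable_const.indicator hbad), lintegral_indicator hbad,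
          setLIntegral_const]
    _ ≤ _ := by gcongr

/-- The method of two fuzzy hypotheses, for a functional recentred by a function of the
observation. -/
theorem two_fuzzy_hypotheses {d : ℕ} {κ : Kernel (Fin d → ℝ) ℝ} [IsMarkovKernel κ]
    {t φ : J → ℝ} {u₀ u₁ : Fin d → J → ℝ}
    (hu₀ : ∀ i k, 0 ≤ u₀ i k) (hu₀1 : ∀ i, ∑ k, u₀ i k = 1)
    (hu₁ : ∀ i k, 0 ≤ u₁ i k) (hu₁1 : ∀ i, ∑ k, u₁ i k = 1)
    {f : Fin d → ℝ → ℝ} (hf : ∀ i, Measurable (f i)) {good : Set (Fin d → J)} {R : ENNReal}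
    (hR : ∀ α ∈ good, ∫⁻ y, ∫⁻ x, ENNReal.ofReal ((x - ∑ i, φ (α i)) ^ 2) ∂κ y
      ∂gaussianMeanLaw (fun i => t (α i)) ≤ R)
    {m₀ m₁ Δ a b₀ b₁ : ℝ} (hΔ : 0 < Δ) (hm : m₀ + Δ ≤ m₁) (hb₀0 : 0 ≤ b₀) (hb₁0 : 0 ≤ b₁)
    (ha : ENNReal.ofReal a ≤ ∫⁻ y, min (∏ i, ENNReal.ofReal (mixtureRatio t (u₀ i) (y i)))
      (∏ i, ENNReal.ofReal (mixtureRatio t (u₁ i) (y i)))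
        ∂Measure.pi (fun _ => gaussianReal 0 1))
    (hb₀ : Measure.pi (fun i => jointLaw t (u₀ i)) {ω | (fun i => (ω i).1) ∉ good ∨
      Δ / 4 ≤ |∑ i, (φ (ω i).1 - f i (ω i).2) - m₀|} ≤ ENNReal.ofReal b₀)
    (hb₁ : Measure.pi (fun i => jointLaw t (u₁ i)) {ω | (fun i => (ω i).1) ∉ good ∨
      Δ / 4 ≤ |∑ i, (φ (ω i).1 - f i (ω i).2) - m₁|} ≤ ENNReal.ofReal b₁) :
    ENNReal.ofReal ((Δ / 4) ^ 2 * (a - b₀ - b₁)) ≤ 2 * R := by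
  -- The test compares the recentred estimate with the midpoint. Recentring is legitimate because
  -- `f` depends on the observation alone. The midpoint is at least `Δ / 2` from either mean, so
  -- after a deviation below `Δ / 4` a wrong decision costs an error of at least `Δ / 4`.
  let A : Set ((Fin d → ℝ) × ℝ) := {p | (m₀ + m₁) / 2 ≤ p.2 - ∑ i, f i (p.1 i)}
  have hA : MeasurableSet A := measurableSet_le measurable_const (by fun_prop)
  let ψ₀ : (Fin d → ℝ) → ENNReal := fun y => κ y (Prod.mk y ⁻¹' A)
  let ψ₁ : (Fin d → ℝ) → ENNReal := fun y => κ y (Prod.mk y ⁻¹' Aᶜ)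
  have hψ₀ : Measurable ψ₀ := Kernel.measurable_kernel_prodMk_left hA
  have hψ₁ : Measurable ψ₁ := Kernel.measurable_kernel_prodMk_left hA.compl
  have hψ : ∀ y, ψ₀ y + ψ₁ y = 1 := fun y => by
    simp only [ψ₀, ψ₁, Set.preimage_compl]
    exact prob_add_prob_compl (measurable_prodMk_left hA)
  have hsum : ∀ (α : Fin d → J) (y : Fin d → ℝ),
      ∑ i, (φ (α i) - f i (y i)) = ∑ i, φ (α i) - ∑ i, f i (y i) :=
    fun α y => Finset.sum_sub_distrib _ _
  -- a test decision away from the truth costs at least `(Δ / 4) ^ 2`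
  have hcost : ∀ (α : Fin d → J) (y : Fin d → ℝ) (S : Set ℝ), MeasurableSet S →
      (∀ x ∈ S, Δ / 4 ≤ |x - ∑ i, φ (α i)|) → ENNReal.ofReal ((Δ / 4) ^ 2) * κ y S ≤
        ∫⁻ x, ENNReal.ofReal ((x - ∑ i, φ (α i)) ^ 2) ∂κ y := by
    intro α y S hS hx
    rw [← setLIntegral_const, ← lintegral_indicator hS]
    refine lintegral_mono fun x => ?_
    by_cases hxS : x ∈ S
    · rw [Set.indicator_of_mem hxS]
      refine ENNReal.ofReal_le_ofReal ?_
      rw [← sq_abs (x - _)]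
      have := hx x hxS
      gcongr
    · simp [Set.indicator_of_notMem hxS]
  have h₀ := mul_lintegral_test_le hu₀ hu₀1 hf hR hψ₀ (fun y => prob_le_one)
    (fun α _ y hy => hcost α y _ (measurable_prodMk_left hA) fun x hx => by
      simp only [A, Set.mem_preimage, Set.mem_ofPred_eq] at hx
      rw [hsum, abs_lt] at hy
      exact le_trans (by linarith) (le_abs_self _)) hb₀
  have h₁ := mul_lintegral_test_le hu₁ hu₁1 hf hR hψ₁ (fun y => prob_le_one)
    (fun α _ y hy => hcost α y _ (measurable_prodMk_left hA.compl) fun x hx => by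
      simp only [A, Set.mem_preimage, Set.mem_compl_iff, Set.mem_ofPred_eq, not_le] at hx
      rw [hsum, abs_lt] at hy
      exact le_trans (by linarith) (neg_le_abs _)) hb₁
  set c := ENNReal.ofReal ((Δ / 4) ^ 2)
  set H₀ := fun y : Fin d → ℝ => ∏ i, ENNReal.ofReal (mixtureRatio t (u₀ i) (y i))
  set H₁ := fun y : Fin d → ℝ => ∏ i, ENNReal.ofReal (mixtureRatio t (u₁ i) (y i))
  have hH₀ : Measurable H₀ := by fun_prop
  have key : c * ENNReal.ofReal a ≤ (R + c * ENNReal.ofReal b₀) + (R + c * ENNReal.ofReal b₁) := by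
    refine le_trans ?_ (add_le_add h₀ h₁)
    rw [← mul_add, ← lintegral_add_left (by fun_prop)]
    gcongr
    refine ha.trans (lintegral_mono fun y => ?_)
    calc min (H₀ y) (H₁ y) = min (H₀ y) (H₁ y) * ψ₀ y + min (H₀ y) (H₁ y) * ψ₁ y := by
          rw [← mul_add, hψ, mul_one]
      _ ≤ H₀ y * ψ₀ y + H₁ y * ψ₁ y := by
          gcongr
          · exact min_le_left _ _
          · exact min_le_right _ _
  have hc : (0 : ℝ) ≤ (Δ / 4) ^ 2 := by positivity
  rw [show (Δ / 4) ^ 2 * (a - b₀ - b₁) = (Δ / 4) ^ 2 * a - (Δ / 4) ^ 2 * (b₀ + b₁) by ring,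
    ENNReal.ofReal_sub _ (by positivity), tsub_le_iff_right, ENNReal.ofReal_mul hc,
    ENNReal.ofReal_mul hc, ENNReal.ofReal_add hb₀0 hb₁0]
  refine key.trans (le_of_eq ?_)
  ring

end FuzzyHypotheses

/-! ### Chi-square distance of mixtures and affinity of product laws. -/

theorem integrable_mixtureRatio_mul {J : Type} [Fintype J] (t a b : J → ℝ) :
    Integrable (fun y => mixtureRatio t a y * mixtureRatio t b y) (gaussianReal 0 1) := by
  simp only [mixtureRatio, Finset.sum_mul_sum]
  refine integrable_finsetSum _ fun k _ => integrable_finsetSum _ fun l _ => ?_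
  exact ((integrable_gaussianRatio_mul (t k) (t l)).const_mul (a k * b l)).congr
    (ae_of_all _ fun y => by ring)

theorem integrable_mixtureRatio_sq {J : Type} [Fintype J] (t a : J → ℝ) :
    Integrable (fun y => mixtureRatio t a y ^ 2) (gaussianReal 0 1) := by
  simp only [sq]
  exact integrable_mixtureRatio_mul t a a

theorem integral_mixtureRatio_sq {J : Type} [Fintype J] (t a : J → ℝ) :
    ∫ y, mixtureRatio t a y ^ 2 ∂gaussianReal 0 1 =
      ∑ k, ∑ l, a k * a l * Real.exp (t k * t l) := by
  have h : ∀ y, mixtureRatio t a y ^ 2 =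
      ∑ k, ∑ l, a k * a l * (gaussianRatio (t k) y * gaussianRatio (t l) y) := by
    intro y
    rw [sq, mixtureRatio, Finset.sum_mul_sum]
    exact Finset.sum_congr rfl fun k _ => Finset.sum_congr rfl fun l _ => by ring
  have hi : ∀ k l, Integrable (fun y => a k * a l * (gaussianRatio (t k) y *
      gaussianRatio (t l) y)) (gaussianReal 0 1) := fun k l =>
    (integrable_gaussianRatio_mul (t k) (t l)).const_mul (a k * a l)
  simp only [h]
  rw [integral_finsetSum _ fun k _ => integrable_finsetSum _ fun l _ => hi k l]
  refine Finset.sum_congr rfl fun k _ => ?_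
  rw [integral_finsetSum _ fun l _ => hi k l]
  exact Finset.sum_congr rfl fun l _ => by
    rw [integral_const_mul, integral_gaussianRatio_mul]

/-- Expanding each `exp (t k * t l)` as a power series decouples `k` from `l` and leaves squared
moments. Matched moments thus remove the corresponding terms exactly. -/
theorem hasSum_integral_mixtureRatio_sq {J : Type} [Fintype J] (t a : J → ℝ) :
    HasSum (fun n : ℕ => (∑ k, a k * t k ^ n) ^ 2 / n.factorial)
      (∫ y, mixtureRatio t a y ^ 2 ∂gaussianReal 0 1) := by
  rw [integral_mixtureRatio_sq]
  have h : ∀ k l, HasSum (fun n : ℕ => a k * a l * ((t k * t l) ^ n / n.factorial))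
      (a k * a l * Real.exp (t k * t l)) := fun k l => by
    have := NormedSpace.expSeries_div_hasSum_exp (t k * t l)
    rw [← Real.exp_eq_exp_ℝ] at this
    exact this.mul_left _
  refine (hasSum_sum fun k _ => hasSum_sum fun l _ => h k l).congr_fun ?_
  intro n
  rw [sq, Finset.sum_mul_sum, Finset.sum_div]
  refine Finset.sum_congr rfl fun k _ => ?_
  rw [Finset.sum_div]
  exact Finset.sum_congr rfl fun l _ => by rw [mul_pow]; ring

/-- Mixtures of Gaussians whose mixing weights share all moments up to order `K` are close. -/
theorem integral_mixtureRatio_sq_le {J : Type} [Fintype J] {t a : J → ℝ} {K M A l : ℝ}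
    (hM : 0 ≤ M) (ht : ∀ k, |t k| ≤ M) (ha : ∑ k, |a k| ≤ A) (hl : 1 ≤ l)
    (hmom : ∀ m : ℕ, (m : ℝ) ≤ K → ∑ k, a k * t k ^ m = 0) :
    ∫ y, mixtureRatio t a y ^ 2 ∂gaussianReal 0 1 ≤
      A ^ 2 * (l ^ (-K) * Real.exp (l * M ^ 2)) := by
  have h := hasSum_integral_mixtureRatio_sq t a
  have hexp : HasSum (fun n : ℕ => A ^ 2 * (l ^ (-K) * ((l * M ^ 2) ^ n / n.factorial)))
      (A ^ 2 * (l ^ (-K) * Real.exp (l * M ^ 2))) := by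
    have := NormedSpace.expSeries_div_hasSum_exp (l * M ^ 2)
    rw [← Real.exp_eq_exp_ℝ] at this
    exact (this.mul_left _).mul_left _
  have hl0 : 0 < l := by linarith
  refine hasSum_le (fun n => ?_) h hexp
  by_cases hn : (n : ℝ) ≤ K
  · rw [hmom n hn]
    simp only [ne_eq, OfNat.ofNat_ne_zero, not_false_eq_true, zero_pow, zero_div]
    positivity
  · push Not at hn
    have h1 : |∑ k, a k * t k ^ n| ≤ A * M ^ n := by
      refine (Finset.abs_sum_le_sum_abs _ _).trans ?_
      refine le_trans ?_ (mul_le_mul_of_nonneg_right ha (by positivity))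
      rw [Finset.sum_mul]
      refine Finset.sum_le_sum fun k _ => ?_
      rw [abs_mul, abs_pow]
      have := ht k
      gcongr
    have h2 : (∑ k, a k * t k ^ n) ^ 2 ≤ (A * M ^ n) ^ 2 := sq_le_sq' (neg_le_of_abs_le h1)
      (le_of_abs_le h1)
    -- Only the terms with `n > K` survive; the factor `l ^ (n - K) ≥ 1` bounds their tail by the
    -- full exponential series at `l * M ^ 2`.
    have h3 : 1 ≤ l ^ (-K) * l ^ n := by
      rw [← Real.rpow_natCast l n, ← Real.rpow_add hl0]
      exact Real.one_le_rpow hl (by linarith)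
    calc (∑ k, a k * t k ^ n) ^ 2 / n.factorial ≤ (A * M ^ n) ^ 2 / n.factorial := by gcongr
      _ = 1 * ((A * M ^ n) ^ 2 / n.factorial) := by ring
      _ ≤ (l ^ (-K) * l ^ n) * ((A * M ^ n) ^ 2 / n.factorial) := by gcongr
      _ = _ := by ring

/-- A lower bound for the affinity of two product laws through the chi-square divergence. -/
theorem le_lintegral_min_prod_mixtureRatio {J : Type} [Fintype J] {d : ℕ} {t : J → ℝ} {o : J}
    (ho : t o = 0) {u₀ u₁ : Fin d → J → ℝ} (hu₀ : ∀ i k, 0 ≤ u₀ i k)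
    (hu₀1 : ∀ i, ∑ k, u₀ i k = 1) (hu₁ : ∀ i k, 0 ≤ u₁ i k) (hu₁1 : ∀ i, ∑ k, u₁ i k = 1)
    (huo : ∀ i, 1 / 2 ≤ u₀ i o) {q : Fin d → ℝ}
    (hq : ∀ i, ∫ y, mixtureRatio t (u₁ i - u₀ i) y ^ 2 ∂gaussianReal 0 1 ≤ q i) {E : ℝ}
    (hE1 : 1 ≤ E) (hE : ∏ i, (1 + 2 * q i) ≤ E) :
    ENNReal.ofReal (3 / (4 * E)) ≤
      ∫⁻ y, min (∏ i, ENNReal.ofReal (mixtureRatio t (u₀ i) (y i)))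
        (∏ i, ENNReal.ofReal (mixtureRatio t (u₁ i) (y i)))
          ∂Measure.pi (fun _ => gaussianReal 0 1) := by
  have h0 : ∀ i y, 1 / 2 ≤ mixtureRatio t (u₀ i) y := fun i y =>
    (huo i).trans (le_mixtureRatio (hu₀ i) ho y)
  have h0p : ∀ i y, 0 < mixtureRatio t (u₀ i) y := fun i y => by linarith [h0 i y]
  have hsub : ∀ i y, mixtureRatio t (u₁ i - u₀ i) y =
      mixtureRatio t (u₁ i) y - mixtureRatio t (u₀ i) y := fun i y => by
    simp only [mixtureRatio, Pi.sub_apply, sub_mul, Finset.sum_sub_distrib]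
  let R : Fin d → ℝ → ℝ := fun i y => mixtureRatio t (u₁ i) y ^ 2 / mixtureRatio t (u₀ i) y
  have hRint : ∀ i, Integrable (R i) (gaussianReal 0 1) := fun i => by
    refine ((integrable_mixtureRatio_sq t (u₁ i)).const_mul 2).mono'
      (by fun_prop : Measurable (R i)).aestronglyMeasurable (ae_of_all _ fun y => ?_)
    rw [Real.norm_of_nonneg (by have := h0p i y; positivity), div_le_iff₀ (h0p i y)]
    nlinarith [h0 i y, sq_nonneg (mixtureRatio t (u₁ i) y)]
  have hRle : ∀ i, ∫ y, R i y ∂gaussianReal 0 1 ≤ 1 + 2 * q i := by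
    intro i
    have hb : ∀ y, R i y ≤ (2 * mixtureRatio t (u₁ i) y - mixtureRatio t (u₀ i) y) +
        2 * mixtureRatio t (u₁ i - u₀ i) y ^ 2 := by
      intro y
      rw [hsub, div_le_iff₀ (h0p i y)]
      nlinarith [h0 i y, sq_nonneg (mixtureRatio t (u₁ i) y - mixtureRatio t (u₀ i) y)]
    have hi1 := ((integrable_mixtureRatio t (u₁ i)).const_mul 2).sub
      (integrable_mixtureRatio t (u₀ i))
    have hi2 := (integrable_mixtureRatio_sq t (u₁ i - u₀ i)).const_mul 2
    refine (integral_mono (hRint i) (hi1.add hi2) hb).trans ?_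
    rw [integral_add' hi1 hi2, integral_sub' ((integrable_mixtureRatio t (u₁ i)).const_mul 2)
      (integrable_mixtureRatio t (u₀ i)), integral_const_mul, integral_const_mul,
      integral_mixtureRatio, integral_mixtureRatio, hu₀1, hu₁1]
    linarith [hq i]
  have hR0 : ∀ i y, 0 ≤ R i y := fun i y => by have := h0p i y; positivity
  set γ := Measure.pi fun _ : Fin d => gaussianReal 0 1
  let H₀ : (Fin d → ℝ) → ℝ := fun y => ∏ i, mixtureRatio t (u₀ i) (y i)
  let H₁ : (Fin d → ℝ) → ℝ := fun y => ∏ i, mixtureRatio t (u₁ i) (y i)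
  let H₂ : (Fin d → ℝ) → ℝ := fun y => ∏ i, R i (y i)
  have hH₁i : Integrable H₁ γ := Integrable.fintype_prod fun i => integrable_mixtureRatio t (u₁ i)
  have hH₂i : Integrable H₂ γ := Integrable.fintype_prod hRint
  have hH₁ : ∫ y, H₁ y ∂γ = 1 := by
    have := integral_fintype_prod_eq_prod (𝕜 := ℝ) (μ := fun _ : Fin d => gaussianReal 0 1)
      fun i => mixtureRatio t (u₁ i)
    simp only [γ, H₁]
    rw [this]
    simp [integral_mixtureRatio, hu₁1]
  have hH₂ : ∫ y, H₂ y ∂γ ≤ E := by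
    have := integral_fintype_prod_eq_prod (𝕜 := ℝ) (μ := fun _ : Fin d => gaussianReal 0 1) R
    simp only [γ, H₂]
    rw [this]
    exact (Finset.prod_le_prod (fun i _ => integral_nonneg (hR0 i)) fun i _ => hRle i).trans hE
  have hEp : 0 < E := by linarith
  -- As `H₂ = H₁² / H₀`, completing the square bounds the left side by `H₀`, and `E ≥ 1` bounds it
  -- by `H₁`. It involves only `∫ H₁ = 1` and the second moment `∫ H₂ ≤ E`, hence integrates to at
  -- least `3 / (4 * E)`.
  have hptw : ∀ y, H₁ y / E - H₂ y / (4 * E ^ 2) ≤ min (H₀ y) (H₁ y) := by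
    intro y
    have hp0 : 0 < H₀ y := Finset.prod_pos fun i _ => h0p i _
    have hp1 : 0 ≤ H₁ y := Finset.prod_nonneg fun i _ => mixtureRatio_nonneg t (hu₁ i) _
    have hH : H₂ y = H₁ y ^ 2 / H₀ y := by
      simp only [H₀, H₁, H₂, R, Finset.prod_div_distrib, Finset.prod_pow]
    have h2 : 0 ≤ H₂ y := by rw [hH]; positivity
    refine le_min ?_ ?_
    · have hid : H₁ y / E - H₂ y / (4 * E ^ 2) = H₀ y - H₀ y * (1 - H₁ y / (2 * E * H₀ y)) ^ 2 := by
        rw [hH]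
        field_simp
        ring
      rw [hid]
      have : 0 ≤ H₀ y * (1 - H₁ y / (2 * E * H₀ y)) ^ 2 := by positivity
      linarith
    · have h3 : H₁ y / E ≤ H₁ y := div_le_self hp1 hE1
      have h4 : 0 ≤ H₂ y / (4 * E ^ 2) := by positivity
      linarith
  have hint : Integrable (fun y => H₁ y / E - H₂ y / (4 * E ^ 2)) γ :=
    (hH₁i.div_const _).sub (hH₂i.div_const _)
  have hle : 3 / (4 * E) ≤ ∫ y, (H₁ y / E - H₂ y / (4 * E ^ 2)) ∂γ := by
    rw [integral_sub (hH₁i.div_const _) (hH₂i.div_const _), integral_div, integral_div, hH₁]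
    have : (∫ y, H₂ y ∂γ) / (4 * E ^ 2) ≤ E / (4 * E ^ 2) := by gcongr
    have e : 1 / E - E / (4 * E ^ 2) = 3 / (4 * E) := by field_simp; norm_num
    linarith
  calc ENNReal.ofReal (3 / (4 * E)) ≤
        ENNReal.ofReal (∫ y, (H₁ y / E - H₂ y / (4 * E ^ 2)) ∂γ) := ENNReal.ofReal_le_ofReal hle
    _ ≤ ∫⁻ y, ENNReal.ofReal (H₁ y / E - H₂ y / (4 * E ^ 2)) ∂γ := by
        refine (ENNReal.ofReal_le_ofReal
          (integral_mono hint hint.pos_part fun y => le_max_left _ 0)).trans ?_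
        rw [ofReal_integral_eq_lintegral_ofReal hint.pos_part
          (ae_of_all _ fun y => le_max_right _ 0)]
        exact lintegral_mono fun y => by simp
    _ ≤ _ := by
        refine lintegral_mono fun y => ?_
        refine (ENNReal.ofReal_le_ofReal (hptw y)).trans ?_
        rw [← ENNReal.ofReal_prod_of_nonneg fun i _ => (h0p i _).le,
          ← ENNReal.ofReal_prod_of_nonneg fun i _ => mixtureRatio_nonneg t (hu₁ i) _]
        exact le_min (ENNReal.ofReal_le_ofReal (min_le_left _ _))
          (ENNReal.ofReal_le_ofReal (min_le_right _ _))

/-! ### Posterior variance as a lower bound for the risk. -/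

/-- Independence kills the cross terms. The shift `c` is arbitrary so that the induction can absorb
the first coordinate into it. -/
theorem sum_prod_mul_sq_of_centered {J : Type*} [Fintype J] {d : ℕ} {p X : Fin d → J → ℝ}
    (hp : ∀ i, ∑ k, p i k = 1) (hX : ∀ i, ∑ k, p i k * X i k = 0) (c : ℝ) :
    ∑ α : Fin d → J, (∏ i, p i (α i)) * (c + ∑ i, X i (α i)) ^ 2 =
      c ^ 2 + ∑ i, ∑ k, p i k * X i k ^ 2 := by
  induction d generalizing c with
  | zero => simp
  | succ d ih =>
    rw [← (Fin.consEquiv fun _ => J).sum_comp, Fintype.sum_prod_type]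
    have h1 : ∀ k : J, ∑ β : Fin d → J, (∏ i, p i (Fin.consEquiv (fun _ => J) (k, β) i)) *
        (c + ∑ i, X i (Fin.consEquiv (fun _ => J) (k, β) i)) ^ 2 =
        p 0 k * ((c + X 0 k) ^ 2 + ∑ i : Fin d, ∑ k, p i.succ k * X i.succ k ^ 2) := by
      intro k
      rw [← ih (p := fun i => p i.succ) (X := fun i => X i.succ) (fun i => hp _) (fun i => hX _),
        Finset.mul_sum]
      refine Finset.sum_congr rfl fun β _ => ?_
      simp only [Fin.prod_univ_succ, Fin.sum_univ_succ, Fin.consEquiv_apply, Fin.cons_zero,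
        Fin.cons_succ]
      ring
    rw [Finset.sum_congr rfl fun k _ => h1 k, Fin.sum_univ_succ]
    have h2 : ∀ (S : ℝ) (k : J), p 0 k * ((c + X 0 k) ^ 2 + S) =
        (c ^ 2 + S) * p 0 k + 2 * c * (p 0 k * X 0 k) + p 0 k * X 0 k ^ 2 := fun S k => by ring
    simp only [h2, Finset.sum_add_distrib, ← Finset.mul_sum, hp, hX]
    ring

/-- The posterior variance of a sum of independent terms bounds the posterior risk. -/
theorem sum_prod_variance_le {J : Type*} [Fintype J] {d : ℕ} {a : Fin d → J → ℝ} {φ : J → ℝ}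
    (ha : ∀ i, 0 < ∑ k, a i k) (x : ℝ) :
    ∑ i, ∏ j, (if j = i then ∑ k, a j k * (φ k - (∑ l, a j l * φ l) / ∑ l, a j l) ^ 2
      else ∑ k, a j k) ≤ ∑ α : Fin d → J, (∏ i, a i (α i)) * (x - ∑ i, φ (α i)) ^ 2 := by
  set h : Fin d → ℝ := fun i => ∑ k, a i k with hh
  set m : Fin d → ℝ := fun i => (∑ l, a i l * φ l) / h i with hm
  have hmean : ∀ i, ∑ k, a i k * φ k = h i * m i := fun i => by
    have : h i ≠ 0 := (ha i).ne'
    simp only [hm]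
    field_simp
  have key := sum_prod_mul_sq_of_centered (p := fun i k => a i k / h i)
    (X := fun i k => m i - φ k) (fun i => by
      rw [← Finset.sum_div]; exact div_self (ha i).ne') (fun i => by
      have : ∀ k, a i k / h i * (m i - φ k) = (a i k * m i - a i k * φ k) / h i := fun k => by ring
      simp only [this]
      rw [← Finset.sum_div, Finset.sum_sub_distrib, ← Finset.sum_mul, hmean]
      simp [hh]) (x - ∑ i, m i)
  have hP : 0 < ∏ i, h i := Finset.prod_pos fun i _ => ha i
  have hl : ∑ α : Fin d → J, (∏ i, a i (α i)) * (x - ∑ i, φ (α i)) ^ 2 =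
      (∏ i, h i) * ∑ α : Fin d → J, (∏ i, a i (α i) / h i) *
        (x - ∑ i, m i + ∑ i, (m i - φ (α i))) ^ 2 := by
    rw [Finset.mul_sum]
    refine Finset.sum_congr rfl fun α _ => ?_
    rw [Finset.prod_div_distrib, Finset.sum_sub_distrib]
    have : ∏ i, h i ≠ 0 := hP.ne'
    field_simp
    ring
  rw [hl, key, mul_add, Finset.mul_sum]
  refine le_trans (le_of_eq ?_) (le_add_of_nonneg_left (by positivity))
  refine Finset.sum_congr rfl fun i _ => ?_
  rw [← Finset.mul_prod_erase Finset.univ _ (Finset.mem_univ i),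
    ← Finset.mul_prod_erase Finset.univ h (Finset.mem_univ i), if_pos rfl]
  have e1 : ∏ j ∈ Finset.univ.erase i, (if j = i then ∑ k, a j k * (φ k - m j) ^ 2 else h j) =
      ∏ j ∈ Finset.univ.erase i, h j :=
    Finset.prod_congr rfl fun j hj => if_neg (Finset.ne_of_mem_erase hj)
  have e2 : ∑ k, a i k / h i * (m i - φ k) ^ 2 = (∑ k, a i k * (φ k - m i) ^ 2) / h i := by
    rw [Finset.sum_div]
    exact Finset.sum_congr rfl fun k _ => by ring
  rw [e2]
  have := (ha i).ne'
  change (∑ k, a i k * (φ k - m i) ^ 2) * _ = _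
  rw [e1]
  change h i ≠ 0 at this
  field_simp

/-- The posterior mean of `φ k` given `y`, for weights `u` on `k` and `y ∼ N(t k, 1)`. -/
noncomputable def posteriorMean {J : Type} [Fintype J] (t φ u : J → ℝ) (y : ℝ) : ℝ :=
  (∑ k, u k * gaussianRatio (t k) y * φ k) / mixtureRatio t u y

@[fun_prop] theorem measurable_posteriorMean {J : Type} [Fintype J] (t φ u : J → ℝ) :
    Measurable (posteriorMean t φ u) := by
  unfold posteriorMean; fun_prop

theorem abs_posteriorMean_sub_le {J : Type} [Fintype J] {t φ u : J → ℝ} (hu : ∀ k, 0 ≤ u k)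
    {y : ℝ} (hpos : 0 < mixtureRatio t u y) {c B : ℝ} (hB : ∀ k, |φ k - c| ≤ B) :
    |posteriorMean t φ u y - c| ≤ B := by
  have h : posteriorMean t φ u y - c =
      (∑ k, u k * gaussianRatio (t k) y * (φ k - c)) / mixtureRatio t u y := by
    simp only [mul_sub, Finset.sum_sub_distrib, ← Finset.sum_mul]
    rw [posteriorMean, sub_div]
    congr 1
    rw [eq_div_iff hpos.ne', mul_comm]
    rfl
  rw [h, abs_div, abs_of_pos hpos, div_le_iff₀ hpos, mixtureRatio, Finset.mul_sum]
  refine (Finset.abs_sum_le_sum_abs _ _).trans (Finset.sum_le_sum fun k _ => ?_)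
  have hw := mul_nonneg (hu k) (gaussianRatio_pos (t k) y).le
  rw [abs_mul, abs_of_nonneg hw, mul_comm B]
  exact mul_le_mul_of_nonneg_left (hB k) hw

/-- The posterior second moment of `φ` around `f`, times the density of the observation. -/
noncomputable def spreadDensity {J : Type} [Fintype J] (t φ u : J → ℝ) (f : ℝ → ℝ) (y : ℝ) : ℝ :=
  ∑ k, u k * gaussianRatio (t k) y * (φ k - f y) ^ 2

theorem spreadDensity_nonneg {J : Type} [Fintype J] {t φ u : J → ℝ} (hu : ∀ k, 0 ≤ u k)
    (f : ℝ → ℝ) (y : ℝ) : 0 ≤ spreadDensity t φ u f y :=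
  Finset.sum_nonneg fun k _ => mul_nonneg (mul_nonneg (hu k) (gaussianRatio_pos _ _).le)
    (sq_nonneg _)

theorem integrable_spreadDensity {J : Type} [Fintype J] (t φ u : J → ℝ) {f : ℝ → ℝ}
    (hf : Measurable f) {c : ℝ} (hc : ∀ k y, |φ k - f y| ≤ c) :
    Integrable (spreadDensity t φ u f) (gaussianReal 0 1) := by
  refine integrable_finsetSum _ fun k _ => ?_
  refine ((integrable_gaussianRatio (t k)).const_mul (u k)).mul_bdd (c := c ^ 2)
    (by fun_prop : Measurable fun y => (φ k - f y) ^ 2).aestronglyMeasurable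
    (ae_of_all _ fun y => ?_)
  rw [Real.norm_of_nonneg (sq_nonneg _), ← sq_abs]
  have := hc k y
  gcongr

theorem gaussianMeanLaw_eq_withDensity {d : ℕ} (θ : Fin d → ℝ) :
    gaussianMeanLaw θ = (Measure.pi fun _ => gaussianReal 0 1).withDensity
      fun y => ∏ i, ENNReal.ofReal (gaussianRatio (θ i) (y i)) := by
  have hp : ∀ i : Fin d, IsProbabilityMeasure ((gaussianReal 0 1).withDensity
      fun y => ENNReal.ofReal (gaussianRatio (θ i) y)) := fun i => by
    rw [← gaussianReal_eq_withDensity_ratio]; infer_instance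
  rw [← pi_withDensity (fun _ => gaussianReal 0 1)
    (f := fun i y => ENNReal.ofReal (gaussianRatio (θ i) y)) fun i => by fun_prop]
  exact congrArg Measure.pi (funext fun i => gaussianReal_eq_withDensity_ratio (θ i))

/-- The expected posterior variance under a product prior bounds the maximal risk from below. -/
theorem sum_integral_spreadDensity_posteriorMean_le {J : Type} [Fintype J] {d : ℕ}
    {κ : Kernel (Fin d → ℝ) ℝ} [IsMarkovKernel κ] {t φ : J → ℝ} {o : J} (ho : t o = 0)
    {u : Fin d → J → ℝ} (hu : ∀ i k, 0 ≤ u i k) (hu1 : ∀ i, ∑ k, u i k = 1)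
    (huo : ∀ i, 0 < u i o) {R : ENNReal}
    (hR : ∀ α : Fin d → J, (∀ i, u i (α i) ≠ 0) →
      ∫⁻ y, ∫⁻ x, ENNReal.ofReal ((x - ∑ i, φ (α i)) ^ 2) ∂κ y
        ∂gaussianMeanLaw (fun i => t (α i)) ≤ R) :
    ENNReal.ofReal (∑ i, ∫ y, spreadDensity t φ (u i) (posteriorMean t φ (u i)) y
      ∂gaussianReal 0 1) ≤ R := by
  set γ := Measure.pi fun _ : Fin d => gaussianReal 0 1
  have hpos : ∀ i y, 0 < mixtureRatio t (u i) y := fun i y =>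
    (huo i).trans_le (le_mixtureRatio (hu i) ho y)
  let e : Fin d → ℝ → ℝ := fun i => spreadDensity t φ (u i) (posteriorMean t φ (u i))
  let w : (Fin d → J) → (Fin d → ℝ) → ℝ := fun α y => ∏ i, u i (α i) * gaussianRatio (t (α i)) (y i)
  have hw : ∀ α y, 0 ≤ w α y := fun α y => Finset.prod_nonneg fun i _ =>
    mul_nonneg (hu i _) (gaussianRatio_pos _ _).le
  -- The total posterior variance, weighted by the density of `y`, is `∑ i, ∏ j, g i j (y j)`. In
  -- this unnormalized form each summand factorizes, and the factors with `j ≠ i` integrate to `1`.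
  let g : Fin d → Fin d → ℝ → ℝ := fun i j => if j = i then e j else mixtureRatio t (u j)
  have hg0 : ∀ i j y, 0 ≤ g i j y := fun i j y => by
    simp only [g]
    split_ifs
    · exact spreadDensity_nonneg (hu j) _ y
    · exact (hpos j y).le
  -- the averaged risk
  have havg : ∑ α : Fin d → J, ENNReal.ofReal (∏ i, u i (α i)) *
      ∫⁻ y, ∫⁻ x, ENNReal.ofReal ((x - ∑ i, φ (α i)) ^ 2) ∂κ y
        ∂gaussianMeanLaw (fun i => t (α i)) ≤ R := by
    have h1 : ∀ α : Fin d → J, ENNReal.ofReal (∏ i, u i (α i)) *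
        ∫⁻ y, ∫⁻ x, ENNReal.ofReal ((x - ∑ i, φ (α i)) ^ 2) ∂κ y
          ∂gaussianMeanLaw (fun i => t (α i)) ≤ ENNReal.ofReal (∏ i, u i (α i)) * R := by
      intro α
      by_cases hα : ∀ i, u i (α i) ≠ 0
      · gcongr
        exact hR α hα
      · push Not at hα
        obtain ⟨i, hi⟩ := hα
        have h0 : ∏ i, u i (α i) = 0 := Finset.prod_eq_zero (Finset.mem_univ i) hi
        simp [h0]
    refine (Finset.sum_le_sum fun α _ => h1 α).trans ?_
    rw [← Finset.sum_mul, ← ENNReal.ofReal_sum_of_nonneg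
      fun α _ => Finset.prod_nonneg fun i _ => hu i _, sum_prod_eq_one hu1]
    simp
  have hmeas : ∀ α : Fin d → J, Measurable fun y : Fin d → ℝ =>
      ∫⁻ x, ENNReal.ofReal ((x - ∑ i, φ (α i)) ^ 2) ∂κ y := fun α =>
    Measurable.lintegral_kernel (by fun_prop)
  have hterm : ∀ α : Fin d → J, ENNReal.ofReal (∏ i, u i (α i)) *
      ∫⁻ y, ∫⁻ x, ENNReal.ofReal ((x - ∑ i, φ (α i)) ^ 2) ∂κ y
        ∂gaussianMeanLaw (fun i => t (α i)) =
      ∫⁻ y, ∫⁻ x, ENNReal.ofReal (w α y * (x - ∑ i, φ (α i)) ^ 2) ∂κ y ∂γ := by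
    intro α
    rw [gaussianMeanLaw_eq_withDensity,
      lintegral_withDensity_eq_lintegral_mul _ (by fun_prop) (hmeas α),
      ← lintegral_const_mul _ (by have := hmeas α; fun_prop)]
    refine lintegral_congr fun y => ?_
    rw [Pi.mul_apply, ← mul_assoc, ← ENNReal.ofReal_prod_of_nonneg
      fun i _ => (gaussianRatio_pos _ _).le, ← ENNReal.ofReal_mul
      (Finset.prod_nonneg fun i _ => hu i _), ← Finset.prod_mul_distrib,
      ← lintegral_const_mul _ (by fun_prop)]
    exact lintegral_congr fun x => (ENNReal.ofReal_mul (hw α y)).symm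
  have hmeas' : ∀ α : Fin d → J, Measurable fun y : Fin d → ℝ =>
      ∫⁻ x, ENNReal.ofReal (w α y * (x - ∑ i, φ (α i)) ^ 2) ∂κ y := fun α =>
    Measurable.lintegral_kernel_prod_right'
      (f := fun p : (Fin d → ℝ) × ℝ => ENNReal.ofReal (w α p.1 * (p.2 - ∑ i, φ (α i)) ^ 2))
      (by simp only [w]; fun_prop)
  have hsum : ∫⁻ y, ENNReal.ofReal (∑ i, ∏ j, g i j (y j)) ∂γ ≤ R := by
    refine le_trans ?_ havg
    simp only [hterm]
    rw [← lintegral_finsetSum _ fun α _ => hmeas' α]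
    refine lintegral_mono fun y => ?_
    rw [← lintegral_finsetSum _ fun α _ => by fun_prop]
    calc ENNReal.ofReal (∑ i, ∏ j, g i j (y j)) =
          ∫⁻ x, ENNReal.ofReal (∑ i, ∏ j, g i j (y j)) ∂κ y := by simp
      _ ≤ _ := by
          refine lintegral_mono fun x => ?_
          rw [← ENNReal.ofReal_sum_of_nonneg fun α _ => mul_nonneg (hw α y) (sq_nonneg _)]
          refine ENNReal.ofReal_le_ofReal ?_
          have := sum_prod_variance_le (a := fun i k => u i k * gaussianRatio (t k) (y i))
            (φ := φ) (fun i => hpos i (y i)) x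
          refine le_trans (le_of_eq ?_) this
          refine Finset.sum_congr rfl fun i _ => Finset.prod_congr rfl fun j _ => ?_
          simp only [g]
          split_ifs <;> rfl
  have hφ : ∀ i k y, |φ k - posteriorMean t φ (u i) y| ≤ 2 * ∑ l, |φ l| := by
    intro i k y
    have hb : ∀ l, |φ l - 0| ≤ ∑ l, |φ l| := fun l => by
      rw [sub_zero]
      exact Finset.single_le_sum (f := fun l => |φ l|) (fun l _ => abs_nonneg _)
        (Finset.mem_univ l)
    have h1 := abs_posteriorMean_sub_le (hu i) (hpos i y) hb
    have h2 := hb k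
    rw [sub_zero] at h1 h2
    exact (abs_sub _ _).trans (by linarith)
  have hgi : ∀ i j, Integrable (g i j) (gaussianReal 0 1) := fun i j => by
    simp only [g]
    split_ifs
    · exact integrable_spreadDensity t φ (u j) (measurable_posteriorMean t φ (u j)) (hφ j)
    · exact integrable_mixtureRatio t (u j)
  have hGi : ∀ i, Integrable (fun y : Fin d → ℝ => ∏ j, g i j (y j)) γ := fun i =>
    Integrable.fintype_prod (hgi i)
  have hint : ∑ i, ∫ y, e i y ∂gaussianReal 0 1 = ∫ y, ∑ i, ∏ j, g i j (y j) ∂γ := by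
    rw [integral_finsetSum _ fun i _ => hGi i]
    refine Finset.sum_congr rfl fun i _ => ?_
    have h := integral_fintype_prod_eq_prod (𝕜 := ℝ) (μ := fun _ : Fin d => gaussianReal 0 1) (g i)
    simp only [γ]
    rw [h, ← Finset.mul_prod_erase Finset.univ _ (Finset.mem_univ i)]
    have : ∏ j ∈ Finset.univ.erase i, ∫ y, g i j y ∂gaussianReal 0 1 = 1 := by
      refine Finset.prod_eq_one fun j hj => ?_
      simp only [g, if_neg (Finset.ne_of_mem_erase hj)]
      rw [integral_mixtureRatio, hu1]
    rw [this, mul_one]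
    simp [g]
  rw [hint, ofReal_integral_eq_lintegral_ofReal (integrable_finsetSum _ fun i _ => hGi i)
    (ae_of_all _ fun y => Finset.sum_nonneg fun i _ => Finset.prod_nonneg fun j _ => hg0 i j _)]
  exact hsum

/-! ### Reduction to single estimators and contaminated priors. -/

/-- To bound the minimax risk from below it is enough to bound every uniform risk bound. -/
theorem le_minimaxQuadraticRisk {d : ℕ} {F : ℝ → ℝ} {Θ : Set (Fin d → ℝ)} {X : ENNReal}
    (h : ∀ (κ : Kernel (Fin d → ℝ) ℝ) (_ : IsMarkovKernel κ) (R : ENNReal),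
      (∀ θ ∈ Θ, ∫⁻ y, ∫⁻ x, ENNReal.ofReal ((x - ∑ i, F (θ i)) ^ 2) ∂κ y ∂gaussianMeanLaw θ ≤ R) →
        X ≤ R) : X ≤ minimaxQuadraticRisk F Θ := by
  refine le_iInf₂ fun κ hκ => h κ hκ _ fun θ hθ => ?_
  refine le_trans (le_of_eq ?_) (le_iSup _ (⟨θ, hθ⟩ : Θ))
  rw [Kernel.lintegral_comp _ _ _ (by fun_prop)]
  rfl

theorem comp_mem_sparseSet {J : Type} {d s : ℕ} {t : J → ℝ} {o : J} {M : ℝ} (hM : 0 ≤ M)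
    (ho : t o = 0) (ht : ∀ k, |t k| ≤ M) {α : Fin d → J} {S : Finset (Fin d)}
    (hS : ∀ i, i ∉ S → α i = o) (hcard : S.card ≤ s) :
    (fun i => t (α i)) ∈ sparseSet d s M := by
  refine ⟨le_trans (Finset.card_le_card fun i hi => ?_) hcard,
    (pi_norm_le_iff_of_nonneg hM).mpr fun i => ht _⟩
  by_contra hiS
  simp [hS i hiS, ho] at hi

open Classical in
/-- The weights of the mixture of the point mass at `o` and of `w`, with proportion `p` of `w`. -/
noncomputable def contaminatedWeight {J : Type} (o : J) (w : J → ℝ) (p : ℝ) (k : J) : ℝ :=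
  (if k = o then 1 - p else 0) + p * w k

section ContaminatedWeight

variable {J : Type} {o : J} {w : J → ℝ} {p : ℝ}

theorem contaminatedWeight_nonneg (hw : ∀ k, 0 ≤ w k) (hp0 : 0 ≤ p) (hp : p ≤ 1 / 2) (k : J) :
    0 ≤ contaminatedWeight o w p k := by
  have := mul_nonneg hp0 (hw k)
  unfold contaminatedWeight
  split_ifs <;> linarith

theorem half_le_contaminatedWeight (hw : ∀ k, 0 ≤ w k) (hp0 : 0 ≤ p) (hp : p ≤ 1 / 2) :
    1 / 2 ≤ contaminatedWeight o w p o := by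
  have := mul_nonneg hp0 (hw o)
  simp only [contaminatedWeight, if_true]
  linarith

theorem contaminatedWeight_of_ne {k : J} (hk : k ≠ o) : contaminatedWeight o w p k = p * w k := by
  simp [contaminatedWeight, hk]

theorem contaminatedWeight_sub (w₀ w₁ : J → ℝ) :
    contaminatedWeight o w₁ p - contaminatedWeight o w₀ p = fun k => p * (w₁ k - w₀ k) := by
  funext k
  simp only [Pi.sub_apply, contaminatedWeight]
  ring

variable [Fintype J]

theorem sum_contaminatedWeight (hw : ∑ k, w k = 1) : ∑ k, contaminatedWeight o w p k = 1 := by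
  simp only [contaminatedWeight, Finset.sum_add_distrib, ← Finset.mul_sum, hw]
  rw [Finset.sum_eq_single_of_mem o (Finset.mem_univ o) fun k _ hk => if_neg hk, if_pos rfl]
  ring

theorem sum_contaminatedWeight_mul_le {g : J → ℝ} {c : ℝ} (hgo : g o = 0) (hg : ∀ k, g k ≤ c)
    (hw : ∀ k, 0 ≤ w k) (hw1 : ∑ k, w k = 1) (hp0 : 0 ≤ p) :
    ∑ k, contaminatedWeight o w p k * g k ≤ p * c := by
  have h : ∀ k, contaminatedWeight o w p k * g k ≤ p * c * w k := by
    intro k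
    by_cases hk : k = o
    · subst hk
      rw [hgo, mul_zero]
      have h1 := hg k
      rw [hgo] at h1
      exact mul_nonneg (mul_nonneg hp0 h1) (hw k)
    · rw [contaminatedWeight_of_ne hk, mul_right_comm p c]
      exact mul_le_mul_of_nonneg_left (hg k) (mul_nonneg hp0 (hw k))
  refine (Finset.sum_le_sum fun k _ => h k).trans (le_of_eq ?_)
  rw [← Finset.mul_sum, hw1, mul_one]

end ContaminatedWeight

theorem mixtureRatio_const_mul {J : Type} [Fintype J] (t a : J → ℝ) (c y : ℝ) :
    mixtureRatio t (fun k => c * a k) y = c * mixtureRatio t a y := by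
  simp only [mixtureRatio, Finset.mul_sum, mul_assoc]

/-- Nonnegativity of the variance; it turns the chi-square bound into a total variation bound. -/
theorem sq_integral_abs_mixtureRatio_le {J : Type} [Fintype J] (t a : J → ℝ) :
    (∫ y, |mixtureRatio t a y| ∂gaussianReal 0 1) ^ 2 ≤
      ∫ y, mixtureRatio t a y ^ 2 ∂gaussianReal 0 1 := by
  have hL : MemLp (fun y => |mixtureRatio t a y|) 2 (gaussianReal 0 1) := by
    rw [memLp_two_iff_integrable_sq (by fun_prop : Measurable _).aestronglyMeasurable]
    simpa only [sq_abs] using integrable_mixtureRatio_sq t a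
  have h := variance_nonneg (fun y => |mixtureRatio t a y|) (gaussianReal 0 1)
  rw [variance_eq_sub hL] at h
  simp only [Pi.pow_apply, sq_abs] at h
  linarith

/-! ### Fuzzy hypotheses for contaminated priors; the small oscillation regime. -/

section Mixtures

variable {J : Type} [Fintype J] [MeasurableSpace J] [DiscreteMeasurableSpace J]

theorem integral_jointLaw_fst (t : J → ℝ) {u : J → ℝ} (hu : ∀ k, 0 ≤ u k) (g : J → ℝ) :
    ∫ z, g z.1 ∂jointLaw t u = ∑ k, u k * g k := by
  have hg : Measurable g := measurable_of_countable g
  rw [integral_jointLaw t hu (g := fun z => g z.1) (hg.comp measurable_fst) (c := ∑ k, |g k|) fun z =>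
    Finset.single_le_sum (f := fun k => |g k|) (fun k _ => abs_nonneg _) (Finset.mem_univ z.1),
    ← integral_mixtureRatio t]
  refine integral_congr_ae (ae_of_all _ fun y => ?_)
  exact Finset.sum_congr rfl fun k _ => by ring

/-- The method of two fuzzy hypotheses for contaminated product priors. -/
theorem le_risk_of_contaminated {d : ℕ} {κ : Kernel (Fin d → ℝ) ℝ} [IsMarkovKernel κ]
    {t φ w₀ w₁ : J → ℝ} {o : J} (ho : t o = 0) (hw₀ : ∀ k, 0 ≤ w₀ k) (hw₁ : ∀ k, 0 ≤ w₁ k)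
    (hw₀1 : ∑ k, w₀ k = 1) (hw₁1 : ∑ k, w₁ k = 1) {p : Fin d → ℝ} (hp0 : ∀ i, 0 ≤ p i)
    (hp : ∀ i, p i ≤ 1 / 2) {f : Fin d → ℝ → ℝ} (hf : ∀ i, Measurable (f i)) {c : ℝ}
    (hc : ∀ i k y, |φ k - f i y| ≤ c) {good : Set (Fin d → J)} {R : ENNReal}
    (hR : ∀ α ∈ good, ∫⁻ y, ∫⁻ x, ENNReal.ofReal ((x - ∑ i, φ (α i)) ^ 2) ∂κ y
      ∂gaussianMeanLaw (fun i => t (α i)) ≤ R) {Δ : ℝ} (hΔ : 0 < Δ)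
    (hQ : (∑ i, p i ^ 2) *
      ∫ y, mixtureRatio t (fun k => w₁ k - w₀ k) y ^ 2 ∂gaussianReal 0 1 ≤ 1 / 4)
    (hm : Δ ≤ ∑ i, (∫ z, (φ z.1 - f i z.2) ∂jointLaw t (contaminatedWeight o w₁ (p i)) -
      ∫ z, (φ z.1 - f i z.2) ∂jointLaw t (contaminatedWeight o w₀ (p i))))
    (hV : ∀ w ∈ ({w₀, w₁} : Set (J → ℝ)), ∑ i, ∫ z, (φ z.1 - f i z.2) ^ 2
      ∂jointLaw t (contaminatedWeight o w (p i)) ≤ Δ ^ 2 / 256)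
    (hgood : ∀ w ∈ ({w₀, w₁} : Set (J → ℝ)),
      Measure.pi (fun i => jointLaw t (contaminatedWeight o w (p i)))
        {ω | (fun i => (ω i).1) ∉ good} ≤ ENNReal.ofReal (1 / 16)) :
    ENNReal.ofReal (Δ ^ 2 / 256) ≤ R := by
  set Q := ∫ y, mixtureRatio t (fun k => w₁ k - w₀ k) y ^ 2 ∂gaussianReal 0 1
  have hQ0 : 0 ≤ Q := integral_nonneg fun y => sq_nonneg _
  have hφ : Measurable φ := measurable_of_countable φ
  have hn : ∀ w ∈ ({w₀, w₁} : Set (J → ℝ)), ∀ i k, 0 ≤ contaminatedWeight o w (p i) k := by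
    rintro w (rfl | rfl) i k
    · exact contaminatedWeight_nonneg hw₀ (hp0 i) (hp i) k
    · exact contaminatedWeight_nonneg hw₁ (hp0 i) (hp i) k
  have hs : ∀ w ∈ ({w₀, w₁} : Set (J → ℝ)), ∀ i, ∑ k, contaminatedWeight o w (p i) k = 1 := by
    rintro w (rfl | rfl) i
    · exact sum_contaminatedWeight hw₀1
    · exact sum_contaminatedWeight hw₁1
  have hbad : ∀ w ∈ ({w₀, w₁} : Set (J → ℝ)),
      Measure.pi (fun i => jointLaw t (contaminatedWeight o w (p i)))
        {ω | (fun i => (ω i).1) ∉ good ∨ Δ / 4 ≤ |∑ i, (φ (ω i).1 - f i (ω i).2) -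
          ∑ i, ∫ z, (φ z.1 - f i z.2) ∂jointLaw t (contaminatedWeight o w (p i))|} ≤
        ENNReal.ofReal (1 / 8) := by
    intro w hw
    have hprob := fun i => isProbabilityMeasure_jointLaw t (hn w hw i) (hs w hw i)
    have h1 := pi_deviation_le (fun i => jointLaw t (contaminatedWeight o w (p i)))
      (g := fun i z => φ z.1 - f i z.2) (fun i => by have := hf i; fun_prop)
      (fun i z => hc i z.1 z.2) (hV w hw) (by positivity : 0 < Δ / 4)
    -- Chebyshev at `Δ / 4` and the failure of `good` each cost `1 / 16`. The two bad events cost `1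
    -- / 8` per prior, to be set against the affinity `3 / 8` obtained below with `E = 2`.
    have e1 : Δ ^ 2 / 256 / (Δ / 4) ^ 2 = 1 / 16 := by field_simp; norm_num
    rw [e1] at h1
    refine (measure_union_le _ _).trans ((add_le_add (hgood w hw) h1).trans (le_of_eq ?_))
    rw [← ENNReal.ofReal_add (by norm_num) (by norm_num)]
    norm_num
  have m0 : w₀ ∈ ({w₀, w₁} : Set (J → ℝ)) := Set.mem_insert _ _
  have m1 : w₁ ∈ ({w₀, w₁} : Set (J → ℝ)) := Set.mem_insert_of_mem _ rfl
  have hq : ∀ i, ∫ y, mixtureRatio t (contaminatedWeight o w₁ (p i) -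
      contaminatedWeight o w₀ (p i)) y ^ 2 ∂gaussianReal 0 1 ≤ p i ^ 2 * Q := fun i => by
    simp only [contaminatedWeight_sub, mixtureRatio_const_mul, mul_pow]
    rw [integral_const_mul]
  have hprod : ∏ i, (1 + 2 * (p i ^ 2 * Q)) ≤ 2 := by
    calc ∏ i, (1 + 2 * (p i ^ 2 * Q)) ≤ ∏ i, Real.exp (2 * (p i ^ 2 * Q)) :=
          Finset.prod_le_prod (fun i _ => by positivity) fun i _ => by
            rw [add_comm]; exact Real.add_one_le_exp _
      _ = Real.exp (2 * ((∑ i, p i ^ 2) * Q)) := by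
          rw [← Real.exp_sum, Finset.sum_mul, Finset.mul_sum]
      _ ≤ Real.exp (Real.log 2) := Real.exp_le_exp.mpr (by
          have := Real.log_two_gt_d9; linarith)
      _ = 2 := Real.exp_log (by norm_num)
  have haff := le_lintegral_min_prod_mixtureRatio ho (fun i => hn w₀ m0 i) (fun i => hs w₀ m0 i)
    (fun i => hn w₁ m1 i) (fun i => hs w₁ m1 i)
    (fun i => half_le_contaminatedWeight hw₀ (hp0 i) (hp i)) hq one_le_two hprod
  rw [Finset.sum_sub_distrib] at hm
  have key := two_fuzzy_hypotheses (fun i => hn w₀ m0 i) (fun i => hs w₀ m0 i)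
    (fun i => hn w₁ m1 i) (fun i => hs w₁ m1 i) hf hR hΔ (by linarith) (by norm_num) (by norm_num)
    haff (hbad w₀ m0) (hbad w₁ m1)
  have e2 : (Δ / 4) ^ 2 * (3 / (4 * 2) - 1 / 8 - 1 / 8) = 2 * (Δ ^ 2 / 256) := by ring
  rw [e2, ENNReal.ofReal_mul zero_le_two, ENNReal.ofReal_ofNat] at key
  exact (ENNReal.mul_le_mul_iff_right two_ne_zero ENNReal.ofNat_ne_top).mp key

/-- The lower bound when the fluctuations of the functional under the sparse prior are small. -/
theorem le_risk_of_small_oscillation {d s : ℕ} {κ : Kernel (Fin d → ℝ) ℝ} [IsMarkovKernel κ]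
    {F : ℝ → ℝ} {t w₀ w₁ : J → ℝ} {o : J} {M B δ : ℝ} (hM : 0 ≤ M) (ho : t o = 0)
    (ht : ∀ k, |t k| ≤ M) (hw₀ : ∀ k, 0 ≤ w₀ k) (hw₁ : ∀ k, 0 ≤ w₁ k)
    (hw₀1 : ∑ k, w₀ k = 1) (hw₁1 : ∑ k, w₁ k = 1)
    (hδw : ∑ k, (w₁ k - w₀ k) * F (t k) = 2 * δ) (hδ : 0 < δ) (hB : ∀ k, |F (t k) - F (t o)| ≤ B)
    {R : ENNReal} (hR : ∀ θ ∈ sparseSet d s M, ∫⁻ y, ∫⁻ x,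
      ENNReal.ofReal ((x - ∑ i, F (θ i)) ^ 2) ∂κ y ∂gaussianMeanLaw θ ≤ R)
    (hs8 : 8 ≤ s) (hsd : s ≤ d) (hBδ : B ^ 2 ≤ s * δ ^ 2 / 256)
    (hQ : (s : ℝ) ^ 2 / d * ∫ y, mixtureRatio t (fun k => w₁ k - w₀ k) y ^ 2 ∂gaussianReal 0 1 ≤ 4) :
    ENNReal.ofReal ((s * δ / 2) ^ 2 / 256) ≤ R := by
  classical
  have hs8' : (8 : ℝ) ≤ s := by exact_mod_cast hs8
  have hsd' : (s : ℝ) ≤ d := by exact_mod_cast hsd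
  have hd : (0 : ℝ) < d := by linarith
  -- The expected number of nonzero coordinates is at most `s / 4`, leaving `3 * s / 4` of slack for
  -- its fluctuations.
  set p : ℝ := s / (4 * d) with hp
  have hp0 : 0 ≤ p := by positivity
  have hp2 : p ≤ 1 / 2 := by
    rw [hp, div_le_iff₀ (by positivity)]; linarith
  have hdp : d * p = s / 4 := by rw [hp]; field_simp
  have hcount : ∀ w : J → ℝ, (∀ k, 0 ≤ w k) → ∑ k, w k = 1 →
      Measure.pi (fun _ : Fin d => jointLaw t (contaminatedWeight o w p))
        {ω | (fun i => (ω i).1) ∉ {α : Fin d → J | (fun i => t (α i)) ∈ sparseSet d s M}} ≤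
          ENNReal.ofReal (1 / 16) := by
    intro w hw hw1
    have hn := contaminatedWeight_nonneg (o := o) hw hp0 hp2
    have hprob := isProbabilityMeasure_jointLaw t hn (sum_contaminatedWeight hw1)
    let g : J → ℝ := fun k => if k = o then 0 else 1
    have hg : Measurable g := measurable_of_countable g
    have hg1 : ∀ k, g k ≤ 1 := fun k => by simp only [g]; split_ifs <;> norm_num
    have hgsq : ∀ k, g k ^ 2 = g k := fun k => by simp only [g]; split_ifs <;> norm_num
    have hmean : ∫ z, g z.1 ∂jointLaw t (contaminatedWeight o w p) ≤ p := by
      rw [integral_jointLaw_fst t hn]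
      simpa using sum_contaminatedWeight_mul_le (o := o) (g := g) (by simp [g]) hg1 hw hw1 hp0
    have h := pi_deviation_le (fun _ : Fin d => jointLaw t (contaminatedWeight o w p))
      (g := fun _ z => g z.1) (fun _ => hg.comp measurable_fst) (c := 1)
      (fun _ z => by simp only [g]; split_ifs <;> norm_num) (v := s / 4) (by
        simp only [hgsq, Finset.sum_const, Finset.card_univ, Fintype.card_fin, nsmul_eq_mul]
        rw [← hdp]
        gcongr) (a := 3 * s / 4) (by positivity)
    refine (measure_mono fun ω hω => ?_).trans (h.trans (ENNReal.ofReal_le_ofReal ?_))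
    · simp only [Set.mem_ofPred_eq] at hω ⊢
      by_contra hcon
      rw [not_le] at hcon
      refine hω (comp_mem_sparseSet (S := {i | (ω i).1 ≠ o}) hM ho ht (fun i hi => ?_) ?_)
      · simpa using hi
      · have h1 : ∑ i, g (ω i).1 = (Finset.card {i | (ω i).1 ≠ o} : ℝ) := by
          simp only [g]
          rw [Finset.card_filter]
          push_cast
          exact Finset.sum_congr rfl fun i _ => by simp [ite_not]
        have h2 := (le_abs_self _).trans_lt hcon
        rw [h1, Finset.sum_const, Finset.card_univ, Fintype.card_fin, nsmul_eq_mul] at h2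
        have h3 : (d : ℝ) * ∫ z, g z.1 ∂jointLaw t (contaminatedWeight o w p) ≤ s / 4 := by
          rw [← hdp]; gcongr
        have h4 : (Finset.card {i | (ω i).1 ≠ o} : ℝ) < s := by linarith
        exact_mod_cast h4.le
    -- The Chebyshev bound is `4 / (9 * s)`, which is at most `1 / 16` because `s ≥ 8`.
    · rw [div_le_div_iff₀ (by positivity) (by norm_num)]
      nlinarith
  refine le_risk_of_contaminated (φ := fun k => F (t k)) (p := fun _ => p)
    (f := fun _ _ => F (t o)) ho hw₀ hw₁ hw₀1 hw₁1 (fun _ => hp0) (fun _ => hp2)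
    (fun _ => measurable_const) (c := B) (fun _ k _ => hB k)
    (good := {α | (fun i => t (α i)) ∈ sparseSet d s M}) (fun α hα => hR _ hα) (by positivity)
    ?_ ?_ ?_ ?_
  · have e : ∑ _i : Fin d, p ^ 2 = (s : ℝ) ^ 2 / d / 16 := by
      rw [Finset.sum_const, Finset.card_univ, Fintype.card_fin, nsmul_eq_mul, hp]
      field_simp
      norm_num
    rw [e]
    linarith
  · have h : ∀ w : J → ℝ, (∀ k, 0 ≤ w k) →
        ∫ z, (F (t z.1) - F (t o)) ∂jointLaw t (contaminatedWeight o w p) =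
          ∑ k, contaminatedWeight o w p k * (F (t k) - F (t o)) := fun w hw =>
      integral_jointLaw_fst t (contaminatedWeight_nonneg hw hp0 hp2) fun k => F (t k) - F (t o)
    have e1 : ∫ z, (F (t z.1) - F (t o)) ∂jointLaw t (contaminatedWeight o w₁ p) -
        ∫ z, (F (t z.1) - F (t o)) ∂jointLaw t (contaminatedWeight o w₀ p) = p * (2 * δ) := by
      rw [h w₁ hw₁, h w₀ hw₀, ← Finset.sum_sub_distrib, ← hδw, Finset.mul_sum]
      have e2 : ∀ k, contaminatedWeight o w₁ p k * (F (t k) - F (t o)) -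
          contaminatedWeight o w₀ p k * (F (t k) - F (t o)) =
          p * ((w₁ k - w₀ k) * F (t k)) - p * F (t o) * (w₁ k - w₀ k) := fun k => by
        have := congrFun (contaminatedWeight_sub (o := o) (p := p) w₀ w₁) k
        rw [← sub_mul, ← Pi.sub_apply, this]
        ring
      rw [Finset.sum_congr rfl fun k _ => e2 k, Finset.sum_sub_distrib, ← Finset.mul_sum _ _
        (p * F (t o)), Finset.sum_sub_distrib, hw₀1, hw₁1]
      ring
    rw [Finset.sum_congr rfl fun i _ => e1, Finset.sum_const, Finset.card_univ, Fintype.card_fin,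
      nsmul_eq_mul, ← mul_assoc, hdp]
    exact le_of_eq (by ring)
  · have h : ∀ w : J → ℝ, (∀ k, 0 ≤ w k) → ∑ k, w k = 1 →
        ∑ _i : Fin d, ∫ z, (F (t z.1) - F (t o)) ^ 2 ∂jointLaw t (contaminatedWeight o w p) ≤
          (s * δ / 2) ^ 2 / 256 := fun w hw hw1 => by
      rw [integral_jointLaw_fst t (contaminatedWeight_nonneg hw hp0 hp2)
        (fun k => (F (t k) - F (t o)) ^ 2), Finset.sum_const, Finset.card_univ, Fintype.card_fin,
        nsmul_eq_mul]
      have h1 := sum_contaminatedWeight_mul_le (o := o) (g := fun k => (F (t k) - F (t o)) ^ 2)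
        (c := B ^ 2) (by simp) (fun k => by
          rw [← sq_abs]
          have := hB k
          gcongr) hw hw1 hp0
      calc (d : ℝ) * _ ≤ d * (p * B ^ 2) := by gcongr
        _ = s / 4 * B ^ 2 := by rw [← mul_assoc, hdp]
        _ ≤ s / 4 * (s * δ ^ 2 / 256) := by gcongr
        _ = _ := by ring
    rintro w (rfl | rfl)
    · exact h _ hw₀ hw₀1
    · exact h _ hw₁ hw₁1
  · rintro w (rfl | rfl)
    · exact hcount _ hw₀ hw₀1
    · exact hcount _ hw₁ hw₁1

end Mixtures

/-! ### Recentring by the posterior mean; the close mixtures regime. -/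

theorem integrable_posteriorError {J : Type} {t φ : J → ℝ} (a : J → ℝ) {f : ℝ → ℝ} (hf : Measurable f)
    {c : ℝ} (hc : ∀ k y, |φ k - f y| ≤ c) (k : J) :
    Integrable (fun y => a k * gaussianRatio (t k) y * (φ k - f y)) (gaussianReal 0 1) :=
  ((integrable_gaussianRatio (t k)).const_mul (a k)).mul_bdd (c := c)
    (by fun_prop : Measurable fun y => φ k - f y).aestronglyMeasurable
    (ae_of_all _ fun y => hc k y)

section Mixtures

variable {J : Type} [Fintype J] [MeasurableSpace J] [DiscreteMeasurableSpace J]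

/-- If the mixtures with weights `w₀` and `w₁` are close, recentring `φ` by a bounded function of
the observation hardly changes the gap of the means. -/
theorem le_integral_jointLaw_sub {t φ w₀ w₁ : J → ℝ} {o : J} {p B δ c : ℝ} {f : ℝ → ℝ}
    (hf : Measurable f) (hw₀ : ∀ k, 0 ≤ w₀ k) (hw₁ : ∀ k, 0 ≤ w₁ k)
    (hw₀1 : ∑ k, w₀ k = 1) (hw₁1 : ∑ k, w₁ k = 1) (hp0 : 0 ≤ p) (hp : p ≤ 1 / 2)
    (hδw : ∑ k, (w₁ k - w₀ k) * φ k = 2 * δ) (hδ : 0 ≤ δ) (hB : ∀ y, |f y - φ o| ≤ B)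
    (hc : ∀ k y, |φ k - f y| ≤ c)
    (hQ : B ^ 2 * ∫ y, mixtureRatio t (fun k => w₁ k - w₀ k) y ^ 2 ∂gaussianReal 0 1 ≤ δ ^ 2) :
    p * δ ≤ ∫ z, (φ z.1 - f z.2) ∂jointLaw t (contaminatedWeight o w₁ p) -
      ∫ z, (φ z.1 - f z.2) ∂jointLaw t (contaminatedWeight o w₀ p) := by
  have hφ : Measurable φ := measurable_of_countable φ
  have hm : Measurable fun z : J × ℝ => φ z.1 - f z.2 := by fun_prop
  set a : J → ℝ := fun k => w₁ k - w₀ k with ha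
  have hi := fun b => integrable_posteriorError (t := t) b hf hc
  rw [integral_jointLaw t (contaminatedWeight_nonneg hw₁ hp0 hp) hm fun z => hc z.1 z.2,
    integral_jointLaw t (contaminatedWeight_nonneg hw₀ hp0 hp) hm fun z => hc z.1 z.2,
    ← integral_sub (integrable_finsetSum _ fun k _ => hi _ k)
      (integrable_finsetSum _ fun k _ => hi _ k)]
  have e1 : ∀ y, (∑ k, contaminatedWeight o w₁ p k * gaussianRatio (t k) y * (φ k - f y)) -
      ∑ k, contaminatedWeight o w₀ p k * gaussianRatio (t k) y * (φ k - f y) =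
      p * (mixtureRatio t (fun k => a k * φ k) y - φ o * mixtureRatio t a y
        - (f y - φ o) * mixtureRatio t a y) := by
    intro y
    simp only [mixtureRatio, ← Finset.sum_sub_distrib, Finset.mul_sum]
    refine Finset.sum_congr rfl fun k _ => ?_
    have := congrFun (contaminatedWeight_sub (o := o) (p := p) w₀ w₁) k
    rw [← sub_mul, ← sub_mul, ← Pi.sub_apply, this]
    ring
  have hfm : Integrable (fun y => (f y - φ o) * mixtureRatio t a y) (gaussianReal 0 1) :=
    (integrable_mixtureRatio t a).bdd_mul (c := B)
      (by fun_prop : Measurable fun y => f y - φ o).aestronglyMeasurable (ae_of_all _ hB)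
  have hj := (integrable_mixtureRatio t a).const_mul (φ o)
  have hj' : Integrable (fun y => mixtureRatio t (fun k => a k * φ k) y -
      φ o * mixtureRatio t a y) (gaussianReal 0 1) := (integrable_mixtureRatio t _).sub hj
  simp only [e1]
  rw [integral_const_mul, integral_sub hj' hfm,
    integral_sub (integrable_mixtureRatio t _) hj, integral_const_mul, integral_mixtureRatio,
    integral_mixtureRatio, hδw]
  have ha0 : ∑ k, a k = 0 := by simp [ha, hw₀1, hw₁1]
  -- The signed mixture has mass zero, so only `f - φ o`, bounded by `B`, matters; Cauchy–Schwarz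
  -- gives `B√Q ≤ δ`. Recentring costs at most half of the gap `2 * p * δ`.
  have habs : ∫ y, (f y - φ o) * mixtureRatio t a y ∂gaussianReal 0 1 ≤ δ := by
    have h1 : ∫ y, (f y - φ o) * mixtureRatio t a y ∂gaussianReal 0 1 ≤
        B * ∫ y, |mixtureRatio t a y| ∂gaussianReal 0 1 := by
      rw [← integral_const_mul]
      refine integral_mono hfm ((integrable_mixtureRatio t a).abs.const_mul B) fun y => ?_
      refine (le_abs_self _).trans ?_
      rw [abs_mul]
      exact mul_le_mul_of_nonneg_right (hB y) (abs_nonneg _)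
    refine h1.trans (le_of_sq_le_sq ?_ hδ)
    rw [mul_pow]
    exact (mul_le_mul_of_nonneg_left (sq_integral_abs_mixtureRatio_le t a) (sq_nonneg B)).trans hQ
  rw [ha0]
  exact mul_le_mul_of_nonneg_left (by linarith) hp0

/-- The lower bound when the proportion of nonzero coordinates is not too small. -/
theorem le_risk_of_close_mixtures {d s : ℕ} {κ : Kernel (Fin d → ℝ) ℝ} [IsMarkovKernel κ]
    {F : ℝ → ℝ} {t w₀ w₁ : J → ℝ} {o : J} {M B δ : ℝ} (hM : 0 ≤ M) (ho : t o = 0)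
    (ht : ∀ k, |t k| ≤ M) (hw₀ : ∀ k, 0 ≤ w₀ k) (hw₁ : ∀ k, 0 ≤ w₁ k)
    (hw₀1 : ∑ k, w₀ k = 1) (hw₁1 : ∑ k, w₁ k = 1)
    (hδw : ∑ k, (w₁ k - w₀ k) * F (t k) = 2 * δ) (hδ : 0 < δ) (hB : ∀ k, |F (t k) - F (t o)| ≤ B)
    {R : ENNReal} (hR : ∀ θ ∈ sparseSet d s M, ∫⁻ y, ∫⁻ x,
      ENNReal.ofReal ((x - ∑ i, F (θ i)) ^ 2) ∂κ y ∂gaussianMeanLaw θ ≤ R)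
    (hs : 1 ≤ s) (hsd : s ≤ d)
    (hsQ : s * ∫ y, mixtureRatio t (fun k => w₁ k - w₀ k) y ^ 2 ∂gaussianReal 0 1 ≤ 1)
    (hBQ : B ^ 2 * ∫ y, mixtureRatio t (fun k => w₁ k - w₀ k) y ^ 2 ∂gaussianReal 0 1 ≤ δ ^ 2) :
    ENNReal.ofReal ((s * δ / 2) ^ 2 / 512) ≤ R := by
  classical
  have hs0 : (0 : ℝ) < s := by exact_mod_cast hs
  let φ : J → ℝ := fun k => F (t k)
  -- With the support fixed in the first `s` coordinates, sparsity holds almost surely, while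
  -- proportion `1 / 2` still leaves weight at least `1 / 2` at `o`.
  let p : Fin d → ℝ := fun i => if (i : ℕ) < s then 1 / 2 else 0
  have hp0 : ∀ i, 0 ≤ p i := fun i => by simp only [p]; split_ifs <;> norm_num
  have hp2 : ∀ i, p i ≤ 1 / 2 := fun i => by simp only [p]; split_ifs <;> norm_num
  have hcard : Finset.card {i : Fin d | (i : ℕ) < s} = s := by
    rw [Fin.card_filter_val_lt, min_eq_right hsd]
  have hcard' : (Finset.card {i : Fin d | (i : ℕ) < s} : ℝ) = s := by rw [hcard]
  have hsum : ∑ i, p i = s / 2 := by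
    simp only [p]
    rw [← Finset.sum_filter, Finset.sum_const, nsmul_eq_mul, hcard']
    ring
  have hsumsq : ∑ i, p i ^ 2 = s / 4 := by
    simp only [p, ite_pow]
    rw [Finset.sum_congr rfl fun i _ => by
      rw [show (0 : ℝ) ^ 2 = 0 by norm_num, show (1 / 2 : ℝ) ^ 2 = 1 / 4 by norm_num],
      ← Finset.sum_filter, Finset.sum_const, nsmul_eq_mul, hcard']
    ring
  let u₀ : Fin d → J → ℝ := fun i => contaminatedWeight o w₀ (p i)
  let u₁ : Fin d → J → ℝ := fun i => contaminatedWeight o w₁ (p i)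
  have hu₀ : ∀ i k, 0 ≤ u₀ i k := fun i => contaminatedWeight_nonneg hw₀ (hp0 i) (hp2 i)
  have hu₁ : ∀ i k, 0 ≤ u₁ i k := fun i => contaminatedWeight_nonneg hw₁ (hp0 i) (hp2 i)
  -- Averaging gives one recentring usable under both hypotheses: each prior is at most `2 * u`, so
  -- its mean squared deviation from `f` is at most twice that under `u`.
  let u : Fin d → J → ℝ := fun i k => (u₀ i k + u₁ i k) / 2
  have hu : ∀ i k, 0 ≤ u i k := fun i k => by
    have := hu₀ i k; have := hu₁ i k; simp only [u]; linarith
  have hu1 : ∀ i, ∑ k, u i k = 1 := fun i => by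
    simp only [u, u₀, u₁]
    rw [← Finset.sum_div, Finset.sum_add_distrib, sum_contaminatedWeight hw₀1,
      sum_contaminatedWeight hw₁1]
    norm_num
  have huo : ∀ i, 0 < u i o := fun i => by
    have h0 := half_le_contaminatedWeight (o := o) hw₀ (hp0 i) (hp2 i)
    have h1 := half_le_contaminatedWeight (o := o) hw₁ (hp0 i) (hp2 i)
    simp only [u, u₀, u₁]
    linarith
  have hpos : ∀ i y, 0 < mixtureRatio t (u i) y := fun i y =>
    (huo i).trans_le (le_mixtureRatio (hu i) ho y)
  let f : Fin d → ℝ → ℝ := fun i => posteriorMean t φ (u i)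
  have hf : ∀ i, Measurable (f i) := fun i => measurable_posteriorMean t φ (u i)
  have hfB : ∀ i y, |f i y - φ o| ≤ B := fun i y => abs_posteriorMean_sub_le (hu i) (hpos i y) hB
  have hc : ∀ i k y, |φ k - f i y| ≤ 2 * B := fun i k y => by
    have h1 := abs_le.mp (hB k)
    have h2 := abs_le.mp (hfB i y)
    simp only [φ] at h2 ⊢
    rw [abs_le]
    constructor <;> linarith
  set T := ∑ i, ∫ y, spreadDensity t φ (u i) (f i) y ∂gaussianReal 0 1 with hT
  -- A large expected posterior variance is itself a risk bound. A small one is exactly the variance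
  -- condition, with `Δ = s * δ / 2`, for the fuzzy hypotheses.
  by_cases hTs : (s * δ / 2) ^ 2 / 512 ≤ T
  · refine (ENNReal.ofReal_le_ofReal hTs).trans ?_
    refine sum_integral_spreadDensity_posteriorMean_le ho hu hu1 huo fun α hα => hR _ ?_
    refine comp_mem_sparseSet (S := {i : Fin d | (i : ℕ) < s}) hM ho ht (fun i hi => ?_) hcard.le
    by_contra hio
    refine hα i ?_
    have hpi : p i = 0 := by
      simp only [Finset.mem_filter, Finset.mem_univ, true_and] at hi
      simp only [p, if_neg hi]
    simp only [u, u₀, u₁, contaminatedWeight_of_ne hio, hpi]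
    norm_num
  · push Not at hTs
    have hV : ∀ w : J → ℝ, (∀ k, 0 ≤ w k) → (∀ i k, contaminatedWeight o w (p i) k ≤ 2 * u i k) →
        ∑ i, ∫ z, (φ z.1 - f i z.2) ^ 2 ∂jointLaw t (contaminatedWeight o w (p i)) ≤
          (s * δ / 2) ^ 2 / 256 := by
      intro w hw hle
      have h1 : ∀ i, ∫ z, (φ z.1 - f i z.2) ^ 2 ∂jointLaw t (contaminatedWeight o w (p i)) ≤
          2 * ∫ y, spreadDensity t φ (u i) (f i) y ∂gaussianReal 0 1 := by
        intro i
        have hφ : Measurable φ := measurable_of_countable φ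
        have hm : Measurable fun z : J × ℝ => (φ z.1 - f i z.2) ^ 2 := by
          have := hf i; fun_prop
        rw [integral_jointLaw t (contaminatedWeight_nonneg hw (hp0 i) (hp2 i)) hm
          (c := (2 * B) ^ 2) fun z => by
            rw [abs_of_nonneg (sq_nonneg _), ← sq_abs]
            have := hc i z.1 z.2
            gcongr, ← integral_const_mul]
        refine integral_mono (integrable_spreadDensity t φ (contaminatedWeight o w (p i)) (hf i)
          (hc i)) ((integrable_spreadDensity t φ (u i) (hf i) (hc i)).const_mul 2) fun y => ?_
        simp only [spreadDensity, Finset.mul_sum]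
        refine Finset.sum_le_sum fun k _ => ?_
        rw [← mul_assoc, ← mul_assoc]
        have := gaussianRatio_pos (t k) y
        have := hle i k
        gcongr
      refine (Finset.sum_le_sum fun i _ => h1 i).trans ?_
      rw [← Finset.mul_sum]
      linarith
    refine le_trans (ENNReal.ofReal_le_ofReal ?_) (le_risk_of_contaminated (φ := φ) (p := p)
      (f := f) (c := 2 * B) (Δ := s * δ / 2) ho hw₀ hw₁ hw₀1 hw₁1 hp0 hp2 hf hc
      (good := {α | (fun i => t (α i)) ∈ sparseSet d s M}) (fun α hα => hR _ hα) (by positivity)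
      ?_ ?_ ?_ ?_)
    · have : 0 ≤ (s * δ / 2) ^ 2 := sq_nonneg _
      linarith
    · rw [hsumsq]
      linarith
    · refine le_trans (le_of_eq ?_) (Finset.sum_le_sum fun i _ => le_integral_jointLaw_sub (hf i)
        hw₀ hw₁ hw₀1 hw₁1 (hp0 i) (hp2 i) hδw hδ.le (hfB i) (hc i) hBQ)
      rw [← Finset.sum_mul, hsum]
      ring
    · rintro w (rfl | rfl)
      · exact hV _ hw₀ fun i k => by
          have := hu₁ i k; simp only [u]; change u₀ i k ≤ _; linarith
      · exact hV _ hw₁ fun i k => by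
          have := hu₀ i k; simp only [u]; change u₁ i k ≤ _; linarith
    · have hsupp : ∀ w : J → ℝ, (∀ k, 0 ≤ w k) → ∑ k, w k = 1 →
          Measure.pi (fun i => jointLaw t (contaminatedWeight o w (p i)))
            {ω | (fun i => (ω i).1) ∉ {α : Fin d → J | (fun i => t (α i)) ∈ sparseSet d s M}} ≤
              ENNReal.ofReal (1 / 16) := by
        intro w hw hw1
        have hprob := fun i => isProbabilityMeasure_jointLaw t
          (contaminatedWeight_nonneg (o := o) hw (hp0 i) (hp2 i)) (sum_contaminatedWeight hw1)
        refine le_trans (le_of_eq ?_) zero_le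
        rw [← Set.compl_ofPred, ← mem_ae_iff]
        have hae : ∀ i : Fin d, ¬ ((i : ℕ) < s) →
            ∀ᵐ ω ∂Measure.pi (fun i => jointLaw t (contaminatedWeight o w (p i))), (ω i).1 = o := by
          intro i hi
          have h1 : ∀ᵐ z ∂jointLaw t (contaminatedWeight o w (p i)), z.1 = o := by
            have hpi : p i = 0 := by simp only [p, if_neg hi]
            have hset : MeasurableSet {z : J × ℝ | z.1 = o} :=
              measurable_fst (MeasurableSet.singleton o)
            rw [ae_iff]
            have hset' : MeasurableSet {z : J × ℝ | ¬ z.1 = o} := hset.compl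
            rw [← lintegral_indicator_one hset', lintegral_jointLaw t _ (measurable_one.indicator hset')]
            refine Finset.sum_eq_zero fun k _ => ?_
            by_cases hk : k = o
            · simp [hk]
            · simp [contaminatedWeight_of_ne hk, hpi]
          exact (measurePreserving_eval
            (fun i => jointLaw t (contaminatedWeight o w (p i))) i).quasiMeasurePreserving.ae h1
        have hall : ∀ᵐ ω ∂Measure.pi (fun i => jointLaw t (contaminatedWeight o w (p i))),
            ∀ i : Fin d, ¬ ((i : ℕ) < s) → (ω i).1 = o :=
          ae_all_iff.mpr fun i => ae_all_iff.mpr fun hi => hae i hi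
        filter_upwards [hall] with ω hω
        refine comp_mem_sparseSet (S := {i : Fin d | (i : ℕ) < s}) hM ho ht (fun i hi => ?_)
          hcard.le
        exact hω i (by simpa using hi)
      rintro w (rfl | rfl)
      · exact hsupp _ hw₀ hw₀1
      · exact hsupp _ hw₁ hw₁1

end Mixtures

/-! ### The two-point bound. -/

/-- The two-point lower bound: one coordinate is `0` or `b` with probability one half. -/
theorem le_risk_of_two_points {d s : ℕ} {κ : Kernel (Fin d → ℝ) ℝ} [IsMarkovKernel κ]
    {F : ℝ → ℝ} {M b : ℝ} (hM : 0 ≤ M) (hb : |b| ≤ M) {R : ENNReal}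
    (hR : ∀ θ ∈ sparseSet d s M, ∫⁻ y, ∫⁻ x,
      ENNReal.ofReal ((x - ∑ i, F (θ i)) ^ 2) ∂κ y ∂gaussianMeanLaw θ ≤ R)
    (hs : 1 ≤ s) (hsd : s ≤ d) :
    ENNReal.ofReal ((F b - F 0) ^ 2 / (4 * Real.exp (b ^ 2))) ≤ R := by
  let t : Bool → ℝ := fun k => if k then b else 0
  let φ : Bool → ℝ := fun k => F (t k)
  let i₀ : Fin d := ⟨0, by omega⟩
  let u : Fin d → Bool → ℝ := fun i k => if i = i₀ then 1 / 2 else if k then 0 else 1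
  have hu : ∀ i k, 0 ≤ u i k := fun i k => by simp only [u]; split_ifs <;> norm_num
  have hu1 : ∀ i, ∑ k, u i k = 1 := fun i => by
    by_cases hi : i = i₀ <;> norm_num [u, hi]
  have huo : ∀ i, 0 < u i false := fun i => by
    by_cases hi : i = i₀ <;> norm_num [u, hi]
  have ho : t false = 0 := by simp [t]
  have key := sum_integral_spreadDensity_posteriorMean_le (κ := κ) (t := t) (φ := φ) (R := R)
    ho hu hu1 huo fun α hα => hR _ (comp_mem_sparseSet (o := false) (S := {i₀}) hM ho
      (fun k => by cases k <;> simp [t, hb, hM]) (fun i hi => by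
        by_contra hio
        refine hα i ?_
        rw [Finset.mem_singleton] at hi
        simp [u, hi, hio]) (by simpa using hs))
  refine (ENNReal.ofReal_le_ofReal ?_).trans key
  refine le_trans ?_ (Finset.single_le_sum (fun i _ => integral_nonneg fun y =>
    spreadDensity_nonneg (hu i) _ y) (Finset.mem_univ i₀))
  set D := F b - F 0
  set E := Real.exp (b ^ 2)
  have hE : 1 ≤ E := Real.one_le_exp (sq_nonneg b)
  set l := 1 / (2 * E) with hl
  -- The weighted posterior variance is `D ^ 2 / 2 * (q / (1 + q))`. Since `q * (1 - l * (1 + q)) ^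
  -- 2 ≥ 0`, it dominates a quadratic in `q`, which can be integrated exactly; `l = 1 / (2 * E)`
  -- makes the result at least `D ^ 2 / 2 * l`.
  have hpt : ∀ y, D ^ 2 / 2 * (2 * l * gaussianRatio b y - l ^ 2 * gaussianRatio b y -
      l ^ 2 * (gaussianRatio b y * gaussianRatio b y)) ≤
        spreadDensity t φ (u i₀) (posteriorMean t φ (u i₀)) y := by
    intro y
    have hq := gaussianRatio_pos b y
    set q := gaussianRatio b y
    have h1 : spreadDensity t φ (u i₀) (posteriorMean t φ (u i₀)) y = D ^ 2 / 2 * (q / (1 + q)) := by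
      have hf : posteriorMean t φ (u i₀) y = (F 0 + q * F b) / (1 + q) := by
        simp only [posteriorMean, mixtureRatio, Fintype.sum_bool, u, t, φ, if_true, if_false,
          Bool.false_eq_true, gaussianRatio_zero]
        change (1 / 2 * q * F b + 1 / 2 * 1 * F 0) / (1 / 2 * q + 1 / 2 * 1) = _
        field_simp
        ring
      rw [spreadDensity]
      simp only [hf]
      simp only [Fintype.sum_bool, u, t, φ, if_true, if_false,
        Bool.false_eq_true, gaussianRatio_zero]
      change 1 / 2 * q * (F b - (F 0 + q * F b) / (1 + q)) ^ 2 +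
        1 / 2 * 1 * (F 0 - (F 0 + q * F b) / (1 + q)) ^ 2 = _
      simp only [D]
      field_simp
      ring
    rw [h1]
    refine mul_le_mul_of_nonneg_left ?_ (by positivity)
    rw [le_div_iff₀ (by linarith)]
    nlinarith [mul_nonneg hq.le (sq_nonneg (1 - l * (1 + q)))]
  have hi1 := (integrable_gaussianRatio b).const_mul (2 * l)
  have hi2 := (integrable_gaussianRatio b).const_mul (l ^ 2)
  have hi3 := (integrable_gaussianRatio_mul b b).const_mul (l ^ 2)
  have hi12 : Integrable (fun y => 2 * l * gaussianRatio b y - l ^ 2 * gaussianRatio b y)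
    (gaussianReal 0 1) := hi1.sub hi2
  refine le_trans ?_ (integral_mono ((hi12.sub hi3).const_mul (D ^ 2 / 2))
    (integrable_spreadDensity t φ (u i₀) (measurable_posteriorMean t φ (u i₀))
      (c := |F 0 - F b|) fun k y => ?_) hpt)
  · rw [integral_const_mul, integral_sub' hi12 hi3, integral_sub hi1 hi2, integral_const_mul,
      integral_const_mul, integral_const_mul, integral_gaussianRatio, integral_gaussianRatio_mul,
      ← sq b]
    change _ ≤ D ^ 2 / 2 * (2 * l * 1 - l ^ 2 * 1 - l ^ 2 * E)
    have e1 : D ^ 2 / (4 * E) = D ^ 2 / 2 * l := by rw [hl]; field_simp; norm_num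
    rw [e1]
    refine mul_le_mul_of_nonneg_left ?_ (by positivity)
    have hl0 : 0 < l := by positivity
    have hlE : l * E = 1 / 2 := by rw [hl]; field_simp
    nlinarith
  · have hp : 0 < mixtureRatio t (u i₀) y := (huo i₀).trans_le (le_mixtureRatio (hu i₀) ho y)
    rw [abs_sub_comm]
    refine abs_posteriorMean_sub_le (hu i₀) hp fun l => ?_
    cases k <;> cases l <;> simp [φ, t, abs_sub_comm]

/-! ### Choice of the degree and combination of the three regimes. -/

/-- For the degree `K` of the theorem, the moment-matched mixtures are polynomially close. -/
theorem integral_mixtureRatio_sq_le_approxDegree {J : Type} [Fintype J] {t w₀ w₁ : J → ℝ}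
    {r M : ℝ} (hr : 1 < r) (hM : 0 < M) (hMr : M ^ 2 ≤ Real.log r) (ht : ∀ k, |t k| ≤ M)
    (hw₀ : ∀ k, 0 ≤ w₀ k) (hw₁ : ∀ k, 0 ≤ w₁ k) (hw₀1 : ∑ k, w₀ k = 1) (hw₁1 : ∑ k, w₁ k = 1)
    (hmom : ∀ m : ℕ, (m : ℝ) ≤ approxDegree r M → ∑ k, (w₁ k - w₀ k) * t k ^ m = 0) :
    ∫ y, mixtureRatio t (fun k => w₁ k - w₀ k) y ^ 2 ∂gaussianReal 0 1 ≤ 4 / r ^ 4 := by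
  have hr0 : 0 < r := by linarith
  set L := Real.log r
  have hL : 0 < L := Real.log_pos hr
  -- With this `l`, `l ^ (-K) = exp (-e² L)` and `exp (l * M ^ 2) = exp (e L)`; the exponent `4` of
  -- `r` comes from `e² - e ≥ 4`.
  set l := Real.exp 1 * L / M ^ 2 with hl
  have hle : Real.exp 1 ≤ l := by
    rw [hl, le_div_iff₀ (by positivity)]
    exact mul_le_mul_of_nonneg_left hMr (Real.exp_pos 1).le
  have hl1 : 1 ≤ l := (Real.one_le_exp zero_le_one).trans hle
  have hl0 : 0 < l := by linarith
  have hlog : 1 ≤ Real.log l := by rwa [Real.le_log_iff_exp_le hl0]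
  have hA : ∑ k, |w₁ k - w₀ k| ≤ 2 := by
    calc ∑ k, |w₁ k - w₀ k| ≤ ∑ k, (w₁ k + w₀ k) := Finset.sum_le_sum fun k _ => by
          rw [abs_le]
          constructor <;> linarith [hw₀ k, hw₁ k]
      _ = 2 := by rw [Finset.sum_add_distrib, hw₀1, hw₁1]; norm_num
  refine (integral_mixtureRatio_sq_le hM.le ht hA hl1 hmom).trans ?_
  have h1 : l ^ (-approxDegree r M) = Real.exp (-(Real.exp 2 * L)) := by
    rw [Real.rpow_def_of_pos hl0]
    congr 1
    have : approxDegree r M = Real.exp 2 * L / Real.log l := rfl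
    rw [this]
    field_simp
  have h2 : l * M ^ 2 = Real.exp 1 * L := by rw [hl]; field_simp
  have h3 : Real.exp 2 = Real.exp 1 ^ 2 := by rw [← Real.exp_nat_mul]; norm_num
  have h4 : Real.exp (-(4 * L)) = 1 / r ^ 4 := by
    rw [Real.exp_neg, one_div]
    congr 1
    rw [← Real.exp_log (pow_pos hr0 4), Real.log_pow]
    norm_num [L]
  rw [h1, h2, ← Real.exp_add]
  calc (2 : ℝ) ^ 2 * Real.exp (-(Real.exp 2 * L) + Real.exp 1 * L)
      ≤ 2 ^ 2 * Real.exp (-(4 * L)) := by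
        gcongr
        have := Real.exp_one_gt_d9
        have : 4 ≤ Real.exp 2 - Real.exp 1 := by rw [h3]; nlinarith
        nlinarith
    _ = 4 / r ^ 4 := by rw [h4]; ring

/-- The lower bound in terms of the ratio of the oscillation of `F` to its approximation error. -/
theorem le_minimaxQuadraticRisk_of_oscillation_le {a r₀ S₀ : ℝ} (hr₀ : r₀ = 1024 * a ^ 2 + 1)
    (hS₀ : S₀ = 256 * a ^ 2 * r₀) (ha0 : 0 < a) {d s : ℕ} {M r K δ B : ℝ} {F : ℝ → ℝ} (hs : 1 ≤ s)
    (hsd : s ≤ d) (hr : r = (s : ℝ) ^ 2 / d) (hr8 : 8 ≤ r) (hrs : r ≤ s) (hM : 0 < M)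
    (hM2 : M ^ 2 ≤ Real.log r) (hF : ContinuousOn F (Set.Icc (-M) M))
    (hK : K = approxDegree r M) (hK0 : 0 ≤ K) (hδdef : δ = polyApproxRate F K (-M) M)
    (hδ : 0 < δ) (hB : B = supNormOn (fun x => F x - F 0) (-M) M) (hδB : δ ≤ B)
    (hBδ : B ^ 2 ≤ a ^ 2 * r * δ ^ 2) :
    ENNReal.ofReal (1 / (2048 + 4 * r₀ * S₀ ^ 2) * (s : ℝ) ^ 2 * δ ^ 2) ≤
      minimaxQuadraticRisk F (sparseSet d s M) := by
  have h0 : (0 : ℝ) ∈ Set.Icc (-M) M := ⟨by linarith, hM.le⟩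
  have hFc : ContinuousOn (fun x => F x - F 0) (Set.Icc (-M) M) := hF.sub continuousOn_const
  have hr₀0 : 0 < r₀ := by rw [hr₀]; positivity
  have hS₀0 : 0 < S₀ := by rw [hS₀]; positivity
  have hB0 : 0 ≤ B := hδ.le.trans hδB
  obtain ⟨J, _, o, t, w₀, w₁, ho, ht, hw₀, hw₁, hw₀1, hw₁1, hmom, hgap⟩ :=
    exists_moment_matching hM hK0 hF (hδdef ▸ hδ)
  rw [← hδdef] at hgap
  rw [hK] at hmom
  let _ : MeasurableSpace J := ⊤
  have hdisc : DiscreteMeasurableSpace J := ⟨fun _ => trivial⟩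
  have hQ := integral_mixtureRatio_sq_le_approxDegree (by linarith) hM hM2 ht hw₀ hw₁ hw₀1 hw₁1
    hmom
  set Q := ∫ y, mixtureRatio t (fun k => w₁ k - w₀ k) y ^ 2 ∂gaussianReal 0 1
  have hQ0 : 0 ≤ Q := integral_nonneg fun y => sq_nonneg _
  have hBt : ∀ k, |F (t k) - F (t o)| ≤ B := fun k => by
    rw [ho]
    rw [hB]
    exact abs_le_supNormOn hFc (abs_le.mp (ht k))
  refine le_minimaxQuadraticRisk fun κ hκ R hR => ?_
  have hden : (0 : ℝ) < 2048 + 4 * r₀ * S₀ ^ 2 := by positivity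
  have hr0 : 0 < r := by linarith
  have hr3 : r ≤ r ^ 3 := le_self_pow₀ (by linarith) (by norm_num)
  have hbig : (s * δ / 2) ^ 2 / 512 ≥ 1 / (2048 + 4 * r₀ * S₀ ^ 2) * (s : ℝ) ^ 2 * δ ^ 2 := by
    have h1 : 1 / (2048 + 4 * r₀ * S₀ ^ 2) ≤ 1 / 2048 := by
      gcongr
      have : 0 ≤ 4 * r₀ * S₀ ^ 2 := by positivity
      linarith
    have h2 := mul_le_mul_of_nonneg_right h1 (by positivity : 0 ≤ (s : ℝ) ^ 2 * δ ^ 2)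
    calc _ = 1 / (2048 + 4 * r₀ * S₀ ^ 2) * ((s : ℝ) ^ 2 * δ ^ 2) := by ring
      _ ≤ _ := h2
      _ = _ := by ring
  by_cases hcase : B ^ 2 ≤ s * δ ^ 2 / 256
  · refine le_trans (ENNReal.ofReal_le_ofReal ?_) (le_risk_of_small_oscillation hM.le ho ht hw₀ hw₁
      hw₀1 hw₁1 hgap hδ hBt hR (by exact_mod_cast hr8.trans hrs) hsd hcase ?_)
    · have : 0 ≤ (s * δ / 2) ^ 2 := sq_nonneg _
      linarith
    · rw [← hr]
      calc r * Q ≤ r * (4 / r ^ 4) := by gcongr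
        _ = 4 / r ^ 3 := by field_simp
        _ ≤ 4 := div_le_self (by norm_num) (by linarith)
  · push Not at hcase
    have hsr : s ≤ 256 * a ^ 2 * r := by
      have h1 : s * δ ^ 2 / 256 < a ^ 2 * r * δ ^ 2 := hcase.trans_le hBδ
      have h2 : 0 < δ ^ 2 := by positivity
      by_contra hcon
      push Not at hcon
      nlinarith
    -- `r₀` exceeds `1024 * a ^ 2`, the constant in `s * Q ≤ 1024 * a ^ 2 / r ^ 3`. Below `r₀`, `s ≤
    -- S₀` and `exp (b ^ 2) ≤ r < r₀`, so the two-point bound loses only constants.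
    by_cases hrr : r₀ ≤ r
    · refine le_trans (ENNReal.ofReal_le_ofReal hbig) (le_risk_of_close_mixtures hM.le ho ht hw₀ hw₁
        hw₀1 hw₁1 hgap hδ hBt hR hs hsd ?_ ?_)
      · calc s * Q ≤ 256 * a ^ 2 * r * (4 / r ^ 4) := mul_le_mul hsr hQ hQ0 (by positivity)
          _ = 1024 * a ^ 2 / r ^ 3 := by field_simp; norm_num
          _ ≤ 1 := by rw [div_le_one (by positivity)]; linarith
      · calc B ^ 2 * Q ≤ a ^ 2 * r * δ ^ 2 * (4 / r ^ 4) := mul_le_mul hBδ hQ hQ0 (by positivity)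
          _ = 4 * a ^ 2 / r ^ 3 * δ ^ 2 := by field_simp
          _ ≤ 1 * δ ^ 2 := by
              gcongr
              rw [div_le_one (by positivity)]
              nlinarith [sq_nonneg a]
          _ = δ ^ 2 := one_mul _
    · push Not at hrr
      obtain ⟨b, hb, hmax⟩ := isCompact_Icc.exists_isMaxOn ⟨0, h0⟩ hFc.abs
      have hBb : B ≤ |F b - F 0| := hB ▸ supNormOn_le (by linarith) fun x hx => hmax hx
      refine le_trans (ENNReal.ofReal_le_ofReal ?_)
        (le_risk_of_two_points hM.le (abs_le.mpr hb) hR hs hsd)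
      have hb2 : b ^ 2 ≤ M ^ 2 := by rw [← sq_abs]; gcongr; exact abs_le.mpr hb
      have hexp : Real.exp (b ^ 2) ≤ r₀ := by
        calc Real.exp (b ^ 2) ≤ Real.exp (Real.log r) := Real.exp_le_exp.mpr (hb2.trans hM2)
          _ = r := Real.exp_log hr0
          _ ≤ r₀ := hrr.le
      have hsS : (s : ℝ) ≤ S₀ := hsr.trans (by
        rw [hS₀]
        gcongr)
      have hnum : δ ^ 2 ≤ (F b - F 0) ^ 2 := by
        rw [← sq_abs (F b - F 0)]
        have := hδB.trans hBb
        gcongr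
      calc 1 / (2048 + 4 * r₀ * S₀ ^ 2) * (s : ℝ) ^ 2 * δ ^ 2
          ≤ 1 / (4 * r₀ * S₀ ^ 2) * S₀ ^ 2 * δ ^ 2 := by
            gcongr
            linarith
        _ = δ ^ 2 / (4 * r₀) := by field_simp
        _ ≤ _ := by gcongr

theorem theorem3 :
    ∃ C : ℝ, 1 ≤ C ∧
      ∀ C₁ C₂ : ℝ, 0 < C₁ → 0 < C₂ →
        ∃ C₃ : ℝ, 0 < C₃ ∧
          ∀ (ε₁ ε₂ : ℝ) (d s : ℕ) (M : ℝ) (F : ℝ → ℝ),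
            2 * ε₁ + 2 * ε₂ < 1 →
            1 ≤ s → s ≤ d →
            C * (d : ℝ) ≤ (s : ℝ) ^ 2 →
            0 < M → M ≤ √(Real.log ((s : ℝ) ^ 2 / d)) →
            ContinuousOn F
              (Set.Icc (-√(Real.log ((s : ℝ) ^ 2 / d))) (√(Real.log ((s : ℝ) ^ 2 / d)))) →
            supNormOn (fun x => F x - F 0) (-M) M ≤ C₁ * ((s : ℝ) ^ 2 / d) ^ ε₁ →
            0 < polyApproxRate F (approxDegree ((s : ℝ) ^ 2 / d) M) (-M) M →
            (polyApproxRate F (approxDegree ((s : ℝ) ^ 2 / d) M) (-M) M)⁻¹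
              ≤ C₂ * ((s : ℝ) ^ 2 / d) ^ ε₂ →
            ENNReal.ofReal (C₃ * (s : ℝ) ^ 2 *
                polyApproxRate F (approxDegree ((s : ℝ) ^ 2 / d) M) (-M) M ^ 2)
              ≤ minimaxQuadraticRisk F (sparseSet d s M) := by
  -- The value `8` gives `r ≥ 8`, and `r ≤ s` because `s ≤ d`; hence `s ≥ 8`, as the count of
  -- nonzero coordinates requires.
  refine ⟨8, by norm_num, fun C₁ C₂ hC₁ hC₂ => ?_⟩
  set a := C₁ * C₂ with ha
  have ha0 : 0 < a := by positivity
  refine ⟨1 / (2048 + 4 * (1024 * a ^ 2 + 1) * (256 * a ^ 2 * (1024 * a ^ 2 + 1)) ^ 2),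
    by positivity, ?_⟩
  intro ε₁ ε₂ d s M F hε hs hsd hC hM hML hF hB₁ hδ hδ₂
  set r := (s : ℝ) ^ 2 / d with hr
  set K := approxDegree r M with hK
  set δ := polyApproxRate F K (-M) M with hδdef
  set B := supNormOn (fun x => F x - F 0) (-M) M with hB
  have hs1 : (1 : ℝ) ≤ s := by exact_mod_cast hs
  have hsd' : (s : ℝ) ≤ d := by exact_mod_cast hsd
  have hd : (0 : ℝ) < d := by linarith
  have hr8 : 8 ≤ r := by rwa [hr, le_div_iff₀ hd]
  have hrs : r ≤ s := by
    rw [hr, div_le_iff₀ hd, sq]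
    exact mul_le_mul_of_nonneg_left hsd' (by linarith)
  have hL : 0 < Real.log r := Real.log_pos (by linarith)
  have hM2 : M ^ 2 ≤ Real.log r := by
    rw [← Real.sq_sqrt hL.le]
    gcongr
  have hFM : ContinuousOn F (Set.Icc (-M) M) :=
    hF.mono (Set.Icc_subset_Icc (neg_le_neg hML) hML)
  have hK0 : 0 ≤ K := by
    refine div_nonneg (by positivity) (Real.log_nonneg ?_)
    rw [le_div_iff₀ (by positivity), one_mul]
    nlinarith [Real.add_one_le_exp 1]
  -- The constant polynomial `F 0` is admissible because `K ≥ 0`.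
  have hδB : δ ≤ B := by
    have := polyApproxRate_le F (-M) M (Polynomial.C (F 0)) (K := K) (by simpa using hK0)
    simpa only [Polynomial.eval_C] using this
  have hB0 : 0 ≤ B := hδ.le.trans hδB
  have hBδ : B ^ 2 ≤ a ^ 2 * r * δ ^ 2 := by
    have hr0 : 0 < r := by linarith
    have h1 : B ≤ C₁ * r ^ ε₁ * (C₂ * r ^ ε₂ * δ) := by
      have h2 : 1 ≤ C₂ * r ^ ε₂ * δ := by
        have := mul_le_mul_of_nonneg_right hδ₂ hδ.le
        rwa [inv_mul_cancel₀ hδ.ne'] at this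
      calc B ≤ C₁ * r ^ ε₁ * 1 := by rw [mul_one]; exact hB₁
        _ ≤ _ := mul_le_mul_of_nonneg_left h2 (by positivity)
    have h3 : B ≤ a * r ^ (ε₁ + ε₂) * δ := by
      rw [Real.rpow_add hr0]
      calc B ≤ _ := h1
        _ = _ := by rw [ha]; ring
    -- This is where `2 * ε₁ + 2 * ε₂ < 1` enters: it limits `(B / δ) ^ 2` to `a ^ 2 * r`.
    have h4 : (r ^ (ε₁ + ε₂)) ^ 2 ≤ r := by
      rw [← Real.rpow_natCast, ← Real.rpow_mul hr0.le]
      calc r ^ ((ε₁ + ε₂) * (2 : ℕ)) ≤ r ^ (1 : ℝ) :=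
            Real.rpow_le_rpow_of_exponent_le (by linarith) (by push_cast; linarith)
        _ = r := Real.rpow_one r
    calc B ^ 2 ≤ (a * r ^ (ε₁ + ε₂) * δ) ^ 2 := by gcongr
      _ = a ^ 2 * (r ^ (ε₁ + ε₂)) ^ 2 * δ ^ 2 := by ring
      _ ≤ _ := by gcongr
  exact le_minimaxQuadraticRisk_of_oscillation_le rfl rfl ha0 hs hsd hr hr8 hrs hM hM2 hFM hK hK0
    hδdef hδ hB hδB hBδ
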